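/- For Borel probability measures $\rho,\rho_0$ on $\mathbb R^2$ let $d^2(\rho,\rho_0)=\inf_\gamma \frac12\iint|x-y|^2\,d\gamma(x,y)$, where the infimum is over all Borel measures $\gamma$ on $\mathbb R^2\times\mathbb R^2$ with marginals $\rho$ and $\rho_0$. Put $K(x)=\log\frac1{|x|}$ (with $K(0)=+\infty$), $U^\rho(x)=(\rho*K)(x)=\int\log\frac1{|x-y|}\,d\rho(y)$ and $\widehat\rho(\xi)=\int e^{-2\pi i\langle x,\xi\rangle}\,d\rho(x)$. Let $\rho_0$ be a probability measure on $\mathbb R^2$ with finite second moment (for instance, with compact support), and let $\rho$ be a minimizer of $$J[\rho]=\iint\log\frac1{|x-y|}\,d\rho(x)\,d\rho(y)+d^2(\rho,\rho_0)$$ among all probability measures on $\mathbb R^2$ with finite second moment. Theorem B. The following hold. (1) $\widehat\rho\in L^2(\mathbb R^2)$. (2) $d\rho=f\,dx$ with some $f\ge 0$ in $L^\infty(\mathbb R^2)$. (3) The potential $U^\rho$ is finite and differentiable at every point of $\mathbb R^2$, and $T(x)=x+2\nabla U^\rho(x)$ is the optimal transport map from $\rho$ to $\rho_0$: it pushes $\rho$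 forward to $\rho_0$, it satisfies $\frac12\int|x-T(x)|^2\,d\rho(x)=d^2(\rho,\rho_0)$, and every other map with these two properties equals $T$ $\rho$-almost everywhere. (4) $\nabla U^\rho$ is log-Lipschitz continuous: there is a constant $C$ with $|\nabla U^\rho(x)-\nabla U^\rho(y)|\le C|x-y|\,(1+|\log|x-y||)$ for all $x\ne y$ in $\mathbb R^2$. -/

import Mathlib

open MeasureTheory
open scoped ENNReal

noncomputable section

namespace LogTransport

/-- The Euclidean plane. -/
abbrev Plane : Type := EuclideanSpace ℝ (Fin 2)

/-- The class of Borel probability measures on the plane with finite second moment. -/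
def IsP2 (μ : Measure Plane) : Prop :=
  IsProbabilityMeasure μ ∧ ∫⁻ x, ‖x‖ₑ ^ 2 ∂μ < ∞

/-- The logarithmic kernel `K(x) = log (1 / |x|)`, with the value `+∞` at the origin. -/
def logKernel (x : Plane) : EReal := -ENNReal.log ‖x‖ₑ

/-- The integral of an extended-real function, as the integral of its positive part minus the
integral of its negative part. It has its usual meaning as soon as one of the two is finite. -/
def eintegral {α : Type*} [MeasurableSpace α] (μ : Measure α) (F : α → EReal) : EReal :=
  ((∫⁻ a, (F a).toENNReal ∂μ : ℝ≥0∞) : EReal) - ((∫⁻ a, (-F a).toENNReal ∂μ : ℝ≥0∞) : EReal)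

/-- The logarithmic energy `∬ log (1 / |x - y|) dρ(x) dρ(y)`. For `ρ` with finite second moment
the negative part is integrable, so the value lies in `(-∞, +∞]`. -/
def logEnergy (ρ : Measure Plane) : EReal :=
  eintegral (ρ.prod ρ) fun p => logKernel (p.1 - p.2)

/-- The logarithmic potential `U^ρ(x) = (ρ * K)(x) = ∫ log (1 / |x - y|) dρ(y)`. -/
def logPotential (ρ : Measure Plane) (x : Plane) : EReal :=
  eintegral ρ fun y => logKernel (x - y)

/-- `γ` is a transport plan with marginals `ρ` and `ρ₀`. -/
def IsPlan (ρ ρ₀ : Measure Plane) (γ : Measure (Plane × Plane)) : Prop :=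
  γ.map Prod.fst = ρ ∧ γ.map Prod.snd = ρ₀

/-- The transport cost `½ ∬ |x - y|² dγ(x, y)` of a plan. -/
def planCost (γ : Measure (Plane × Plane)) : ℝ≥0∞ :=
  2⁻¹ * ∫⁻ p, ‖p.1 - p.2‖ₑ ^ 2 ∂γ

/-- The squared Wasserstein distance `d²(ρ, ρ₀) = inf_γ ½ ∬ |x - y|² dγ(x, y)`. -/
def wassersteinSq (ρ ρ₀ : Measure Plane) : ℝ≥0∞ :=
  ⨅ (γ : Measure (Plane × Plane)) (_ : IsPlan ρ ρ₀ γ), planCost γ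

/-- The functional `J[ρ] = ∬ log (1 / |x - y|) dρ(x) dρ(y) + d²(ρ, ρ₀)`. -/
def energyJ (ρ₀ ρ : Measure Plane) : EReal :=
  logEnergy ρ + (wassersteinSq ρ ρ₀ : EReal)

/-- `ρ` minimizes `J` among all probability measures with finite second moment. -/
def IsMinimizer (ρ₀ ρ : Measure Plane) : Prop :=
  IsP2 ρ ∧ ∀ μ : Measure Plane, IsP2 μ → energyJ ρ₀ ρ ≤ energyJ ρ₀ μ

/-- The Fourier transform `ξ ↦ ∫ exp (-2πi ⟨x, ξ⟩) dρ(x)` of a measure. -/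
def fourierMeasure (ρ : Measure Plane) (ξ : Plane) : ℂ :=
  ∫ x, Complex.exp (-2 * Real.pi * Complex.I * (inner ℝ x ξ : ℝ)) ∂ρ

/-- `T` is an optimal transport map from `ρ` to `ρ₀`: it pushes `ρ` forward to `ρ₀` and the plan
that it induces attains the infimum in the Wasserstein distance. -/
def IsOptimalMap (ρ ρ₀ : Measure Plane) (T : Plane → Plane) : Prop :=
  AEMeasurable T ρ ∧ ρ.map T = ρ₀ ∧ 2⁻¹ * ∫⁻ x, ‖x - T x‖ₑ ^ 2 ∂ρ = wassersteinSq ρ ρ₀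

/-- Log-Lipschitz continuity: `|F(x) - F(y)| ≤ C |x - y| (1 + |log |x - y||)` for all `x, y`. -/
def IsLogLipschitz (F : Plane → Plane) : Prop :=
  ∃ C : ℝ, ∀ x y : Plane, ‖F x - F y‖ ≤ C * (‖x - y‖ * (1 + |Real.log ‖x - y‖|))

end LogTransport

end

noncomputable section

namespace LogTransport

/-! The functional is tested on mixtures (1-s)ρ + sμ. The logarithmic energy is quadratic in s, and
mixing a plan for ρ with a plan for μ bounds the transport cost linearly in s. The resulting
inequality `IsMinimizer.first_variation` allows a plan that is optimal only up to ε, so existence of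
an optimal plan is never needed.

Every μ arises by moving the first point of a plan and then spreading it uniformly over a circle.
The mean of log|·| over a circle of radius r about z is log max(|z|, r), which makes the energies
explicit and finite. The mean direction is zero, so spreading adds exactly r²/2 to the transport
cost of each point.

Density: spreading a point x over its circle of radius t lowers the energy to first order by at
least 2 log 2 · ρ(B(x, t/2)) and costs t²/2. Minimality forces ρ(B(x, t/2)) ≤ t²/(4 log 2) almost
everywhere, and Besicovitch differentiation turns this into ρ ≤ (π log 2)⁻¹ dx
(`IsMinimizer.le_smul_volume`). Bounded density gives a differentiable potential U with
log-Lipschitz gradient; f ∈ L¹ ∩ L^∞ ⊂ L² gives the Fourier statement by Plancherel.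

Transport: put D(x, y) = x + 2∇U(x) - y. Moving x by -τ D/|D| changes the functional to first order
by -τ∫|D| dγ. Hence ∫|D| dγ is small for every almost optimal γ
(`IsMinimizer.exists_integral_norm_deviation_le`). The push-forward identity, the optimality of T
and its uniqueness all follow from this one estimate. -/

/-! ### Uniform angles and circle means of the logarithm -/

/-- The uniform probability measure on the angles `(0, 2π]`. -/
def angleMeasure : Measure ℝ :=
  ENNReal.ofReal ((2 * Real.pi)⁻¹) • volume.restrict (Set.Ioc 0 (2 * Real.pi))

/-- The unit vector with a given angle. -/
def direction (θ : ℝ) : Plane := Complex.orthonormalBasisOneI.repr (circleMap 0 1 θ)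

instance : IsProbabilityMeasure angleMeasure := by
  constructor
  have : (0 : ℝ) < 2 * Real.pi := by positivity
  simp only [angleMeasure, Measure.smul_apply, Measure.restrict_apply MeasurableSet.univ,
    Set.univ_inter, Real.volume_Ioc, smul_eq_mul, sub_zero]
  rw [← ENNReal.ofReal_mul (by positivity), inv_mul_cancel₀ this.ne', ENNReal.ofReal_one]

@[fun_prop]
lemma continuous_direction : Continuous direction := by
  unfold direction
  fun_prop

@[fun_prop]
lemma measurable_direction : Measurable direction := continuous_direction.measurable

@[simp]
lemma norm_direction (θ : ℝ) : ‖direction θ‖ = 1 := by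
  simp [direction]

lemma integral_angleMeasure {E : Type*} [NormedAddCommGroup E] [NormedSpace ℝ E] (f : ℝ → E) :
    ∫ θ, f θ ∂angleMeasure = (2 * Real.pi)⁻¹ • ∫ θ in (0 : ℝ)..2 * Real.pi, f θ := by
  rw [angleMeasure, integral_smul_measure, intervalIntegral.integral_of_le (by positivity),
    ENNReal.toReal_ofReal (by positivity)]

lemma integrable_angleMeasure {f : ℝ → ℝ}
    (hf : IntervalIntegrable f volume 0 (2 * Real.pi)) : Integrable f angleMeasure := by
  rw [intervalIntegrable_iff_integrableOn_Ioc_of_le (by positivity)] at hf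
  exact hf.smul_measure ENNReal.ofReal_ne_top

lemma norm_add_smul_direction (z : Plane) (r θ : ℝ) :
    ‖z + r • direction θ‖ =
      ‖circleMap 0 r θ - (-Complex.orthonormalBasisOneI.repr.symm z)‖ := by
  rw [← LinearIsometryEquiv.norm_map Complex.orthonormalBasisOneI.repr]
  simp only [direction, sub_neg_eq_add, map_add, LinearIsometryEquiv.apply_symm_apply]
  rw [add_comm, ← map_smul]
  simp [circleMap]

/-- Newton's theorem in the plane, from Jensen's formula: log|·| is harmonic off the origin, so a
circle that does not enclose the origin gives the value at the centre, and one that encloses it sees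
only its radius. -/
lemma integral_log_norm_add_smul_direction (z : Plane) (r : ℝ) :
    ∫ θ, Real.log ‖z + r • direction θ‖ ∂angleMeasure = Real.log (max ‖z‖ |r|) := by
  rcases eq_or_ne r 0 with rfl | hr
  · simp
  simp_rw [norm_add_smul_direction]
  have h := circleAverage_log_norm_sub_const_eq_log_radius_add_posLog (c := 0) (R := r)
    (a := -Complex.orthonormalBasisOneI.repr.symm z) hr
  rw [Real.circleAverage_def] at h
  rw [integral_angleMeasure, h]
  simp only [zero_sub, neg_neg, LinearIsometryEquiv.norm_map]
  have hr' : 0 < |r| := abs_pos.mpr hr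
  have h2 : Real.posLog (r⁻¹ * ‖z‖) = Real.posLog (|r|⁻¹ * ‖z‖) := by
    rw [← Real.posLog_abs, abs_mul, abs_inv, abs_norm]
  rw [h2, ← Real.log_abs r]
  rcases le_total ‖z‖ |r| with h3 | h3
  · rw [max_eq_right h3, (Real.posLog_eq_zero_iff _).2, add_zero]
    rw [abs_of_nonneg (by positivity)]
    rwa [inv_mul_le_one₀ hr']
  · rw [max_eq_left h3, Real.posLog_eq_log, Real.log_mul, Real.log_inv]
    · ring
    · positivity
    · have := hr'.trans_le h3
      positivity
    · rw [abs_of_nonneg (by positivity)]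
      rwa [one_le_inv_mul₀ hr']

lemma integrable_log_norm_add_smul_direction (z : Plane) (r : ℝ) :
    Integrable (fun θ => Real.log ‖z + r • direction θ‖) angleMeasure := by
  simp_rw [norm_add_smul_direction]
  apply integrable_angleMeasure
  exact MeromorphicOn.circleIntegrable_log_norm
    (f := fun w => w - (-Complex.orthonormalBasisOneI.repr.symm z)) (c := 0) (R := r)
    (fun _ _ => by fun_prop)

lemma integrable_direction : Integrable direction angleMeasure :=
  Integrable.of_bound (C := 1) (by fun_prop) (.of_forall fun θ => by simp)

lemma integral_direction : ∫ θ, direction θ ∂angleMeasure = 0 := by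
  unfold direction
  have h : ∫ θ, circleMap 0 1 θ ∂angleMeasure = 0 := by
    rw [integral_angleMeasure]
    simp only [circleMap, zero_add, Complex.ofReal_one, one_mul]
    have := integral_exp_mul_complex (a := 0) (b := 2 * Real.pi) (c := Complex.I) Complex.I_ne_zero
    simp only [mul_comm Complex.I] at this
    rw [this]
    simp [Complex.exp_two_pi_mul_I]
  have h2 := (Complex.orthonormalBasisOneI.repr.toContinuousLinearEquiv :
    ℂ →L[ℝ] Plane).integral_comp_comm (μ := angleMeasure) (φ := circleMap 0 1) ?_
  · rw [h] at h2
    simpa using h2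
  · exact Integrable.of_bound (C := 1) (by fun_prop) (.of_forall fun θ => by simp)

/-- A nondegenerate circle meets the origin for only countably many angles, so the conventions
`Real.log 0 = 0` and `kerAbs 0 = ∞` may be interchanged under the integral. -/
lemma ae_add_smul_direction_ne_zero (z : Plane) {r : ℝ} (hr : r ≠ 0) :
    ∀ᵐ θ ∂angleMeasure, z + r • direction θ ≠ 0 := by
  unfold angleMeasure
  refine Measure.ae_smul_measure (ae_restrict_of_ae ?_) _
  have := (Set.countable_singleton
    (-Complex.orthonormalBasisOneI.repr.symm z)).preimage_circleMap 0 hr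
  filter_upwards [this.ae_notMem volume] with θ hθ h0
  rw [← norm_eq_zero, norm_add_smul_direction, norm_eq_zero, sub_eq_zero] at h0
  exact hθ h0

/-! ### The absolute value of the kernel -/

/-- The absolute value of the logarithmic kernel, infinite at the origin. -/
def kerAbs (z : Plane) : ℝ≥0∞ := (logKernel z).toENNReal + (-logKernel z).toENNReal

@[fun_prop]
lemma measurable_logKernel : Measurable logKernel := by
  unfold logKernel
  fun_prop

@[fun_prop]
lemma measurable_kerAbs : Measurable kerAbs := by
  unfold kerAbs
  fun_prop

lemma logKernel_of_ne_zero {z : Plane} (hz : z ≠ 0) :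
    logKernel z = ((-Real.log ‖z‖ : ℝ) : EReal) := by
  rw [logKernel, ENNReal.log_pos_real (by simpa using hz) enorm_ne_top]
  simp

lemma kerAbs_of_ne_zero {z : Plane} (hz : z ≠ 0) : kerAbs z = ENNReal.ofReal |Real.log ‖z‖| := by
  rw [kerAbs, logKernel_of_ne_zero hz, ← EReal.coe_neg, neg_neg, EReal.real_coe_toENNReal,
    EReal.real_coe_toENNReal]
  rcases le_total 0 (Real.log ‖z‖) with h | h
  · rw [abs_of_nonneg h, ENNReal.ofReal_of_nonpos (by linarith), zero_add]
  · rw [abs_of_nonpos h, ENNReal.ofReal_of_nonpos h, add_zero]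

@[simp]
lemma kerAbs_zero : kerAbs 0 = ∞ := by
  simp [kerAbs, logKernel]

lemma kerAbs_neg (z : Plane) : kerAbs (-z) = kerAbs z := by
  simp [kerAbs, logKernel]

/-- Reduces the integral of |log| to the signed circle mean, which is known exactly. -/
lemma abs_log_le_neg_log_add {t : ℝ} (ht : 0 ≤ t) : |Real.log t| ≤ -Real.log t + 2 * t := by
  have := Real.log_le_self ht
  rcases le_total 0 (Real.log t) with h | h
  · rw [abs_of_nonneg h]; linarith
  · rw [abs_of_nonpos h]; linarith

lemma lintegral_kerAbs_add_smul_direction_le (z : Plane) {r : ℝ} (hr : r ≠ 0) :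
    ∫⁻ θ, kerAbs (z + r • direction θ) ∂angleMeasure ≤
      ENNReal.ofReal (-Real.log (max ‖z‖ |r|) + 2 * (‖z‖ + |r|)) := by
  have h1 : ∫⁻ θ, kerAbs (z + r • direction θ) ∂angleMeasure =
      ∫⁻ θ, ENNReal.ofReal |Real.log ‖z + r • direction θ‖| ∂angleMeasure := by
    refine lintegral_congr_ae ?_
    filter_upwards [ae_add_smul_direction_ne_zero z hr] with θ hθ
    exact kerAbs_of_ne_zero hθ
  have hi := integrable_log_norm_add_smul_direction z r
  rw [h1, ← ofReal_integral_eq_lintegral_ofReal hi.abs (.of_forall fun _ => abs_nonneg _)]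
  apply ENNReal.ofReal_le_ofReal
  rw [← integral_log_norm_add_smul_direction, ← integral_neg]
  calc ∫ θ, |Real.log ‖z + r • direction θ‖| ∂angleMeasure
      ≤ ∫ θ, (-Real.log ‖z + r • direction θ‖ + 2 * (‖z‖ + |r|)) ∂angleMeasure := by
        refine integral_mono hi.abs (hi.neg.add (integrable_const _)) fun θ => ?_
        refine (abs_log_le_neg_log_add (norm_nonneg _)).trans ?_
        have := norm_add_le z (r • direction θ)
        rw [norm_smul, norm_direction, mul_one, Real.norm_eq_abs] at this
        linarith
    _ = _ := by
        rw [integral_add (f := fun θ => -Real.log ‖z + r • direction θ‖) hi.neg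
          (integrable_const _)]
        simp

/-- Apart from linear growth the bound ignores the position of the singularity. Spreading over
circles of one fixed radius therefore gives finite energy against any measure with finite second
moment. -/
lemma lintegral_kerAbs_le_of_radius_ne_zero (z : Plane) {r : ℝ} (hr : r ≠ 0) :
    ∫⁻ θ, kerAbs (z + r • direction θ) ∂angleMeasure ≤
      ENNReal.ofReal (-Real.log |r| + 2 * (‖z‖ + |r|)) := by
  refine (lintegral_kerAbs_add_smul_direction_le z hr).trans (ENNReal.ofReal_le_ofReal ?_)
  have := Real.log_le_log (abs_pos.2 hr) (le_max_right ‖z‖ |r|)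
  linarith

/-- Spreading never lowers the mean of the logarithm. The bound survives r = 0, as needed when only
part of the mass is spread. -/
lemma lintegral_kerAbs_le_kerAbs_add (z : Plane) (r : ℝ) :
    ∫⁻ θ, kerAbs (z + r • direction θ) ∂angleMeasure ≤
      kerAbs z + ENNReal.ofReal (2 * (‖z‖ + |r|)) := by
  rcases eq_or_ne z 0 with rfl | hz
  · simp
  rcases eq_or_ne r 0 with rfl | hr
  · simp
  refine (lintegral_kerAbs_add_smul_direction_le z hr).trans ?_
  rw [kerAbs_of_ne_zero hz, ← ENNReal.ofReal_add (abs_nonneg _) (by positivity)]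
  apply ENNReal.ofReal_le_ofReal
  have := Real.log_le_log (norm_pos_iff.2 hz) (le_max_left ‖z‖ |r|)
  have := neg_le_abs (Real.log ‖z‖)
  linarith

/-! ### Second moments -/

lemma IsP2.lintegral_enorm_lt_top {μ : Measure Plane} (hμ : IsP2 μ) : ∫⁻ x, ‖x‖ₑ ∂μ < ∞ := by
  have := hμ.1
  calc ∫⁻ x, ‖x‖ₑ ∂μ ≤ ∫⁻ x, (1 + ‖x‖ₑ ^ 2) ∂μ := by
        refine lintegral_mono fun x => ?_
        rcases le_total ‖x‖ₑ 1 with h | h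
        · exact h.trans le_self_add
        · exact (le_self_pow h two_ne_zero).trans le_add_self
    _ < ∞ := by
        rw [lintegral_add_left measurable_const]
        simpa using hμ.2

lemma IsP2.integrable_norm {μ : Measure Plane} (hμ : IsP2 μ) :
    Integrable (fun x => ‖x‖) μ :=
  ⟨by fun_prop, by simpa [HasFiniteIntegral] using hμ.lintegral_enorm_lt_top⟩

lemma enorm_add_sq_le (x y : Plane) : ‖x + y‖ₑ ^ 2 ≤ 2 * (‖x‖ₑ ^ 2 + ‖y‖ₑ ^ 2) := by
  rw [← ofReal_norm, ← ofReal_norm, ← ofReal_norm, ← ENNReal.ofReal_pow (norm_nonneg _),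
    ← ENNReal.ofReal_pow (norm_nonneg _), ← ENNReal.ofReal_pow (norm_nonneg _),
    ← ENNReal.ofReal_add (by positivity) (by positivity),
    show (2 : ℝ≥0∞) * ENNReal.ofReal (‖x‖ ^ 2 + ‖y‖ ^ 2) =
      ENNReal.ofReal (2 * (‖x‖ ^ 2 + ‖y‖ ^ 2)) by rw [ENNReal.ofReal_mul zero_le_two]; simp]
  apply ENNReal.ofReal_le_ofReal
  nlinarith [norm_add_le x y, norm_nonneg (x + y), norm_nonneg x, norm_nonneg y,
    sq_nonneg (‖x‖ - ‖y‖)]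

lemma IsPlan.lintegral_fst {ρ ρ₀ : Measure Plane} {γ : Measure (Plane × Plane)}
    (hγ : IsPlan ρ ρ₀ γ) {f : Plane → ℝ≥0∞} (hf : Measurable f) :
    ∫⁻ p, f p.1 ∂γ = ∫⁻ x, f x ∂ρ := by
  rw [← hγ.1, lintegral_map hf measurable_fst]

lemma IsPlan.lintegral_snd {ρ ρ₀ : Measure Plane} {γ : Measure (Plane × Plane)}
    (hγ : IsPlan ρ ρ₀ γ) {f : Plane → ℝ≥0∞} (hf : Measurable f) :
    ∫⁻ p, f p.2 ∂γ = ∫⁻ x, f x ∂ρ₀ := by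
  rw [← hγ.2, lintegral_map hf measurable_snd]

lemma IsPlan.isProbabilityMeasure {ρ ρ₀ : Measure Plane} [IsProbabilityMeasure ρ]
    {γ : Measure (Plane × Plane)} (hγ : IsPlan ρ ρ₀ γ) : IsProbabilityMeasure γ := by
  refine ⟨?_⟩
  have : γ.map Prod.fst Set.univ = 1 := by rw [hγ.1]; exact measure_univ
  rwa [Measure.map_apply measurable_fst MeasurableSet.univ, Set.preimage_univ] at this

lemma IsPlan.lintegral_sq_lt_top {ρ ρ₀ : Measure Plane} (hρ : IsP2 ρ) (hρ₀ : IsP2 ρ₀)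
    {γ : Measure (Plane × Plane)} (hγ : IsPlan ρ ρ₀ γ) :
    ∫⁻ p, ‖p.1 - p.2‖ₑ ^ 2 ∂γ < ∞ := by
  calc ∫⁻ p, ‖p.1 - p.2‖ₑ ^ 2 ∂γ
      ≤ ∫⁻ p, 2 * (‖p.1‖ₑ ^ 2 + ‖p.2‖ₑ ^ 2) ∂γ := by
        refine lintegral_mono fun p => ?_
        simpa [sub_eq_add_neg] using enorm_add_sq_le p.1 (-p.2)
    _ < ∞ := by
        rw [lintegral_const_mul _ (by fun_prop), lintegral_add_left (by fun_prop),
          hγ.lintegral_fst (f := fun x => ‖x‖ₑ ^ 2) (by fun_prop),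
          hγ.lintegral_snd (f := fun x => ‖x‖ₑ ^ 2) (by fun_prop)]
        exact ENNReal.mul_lt_top (by simp) (ENNReal.add_lt_top.2 ⟨hρ.2, hρ₀.2⟩)

lemma IsPlan.planCost_ne_top {ρ ρ₀ : Measure Plane} (hρ : IsP2 ρ) (hρ₀ : IsP2 ρ₀)
    {γ : Measure (Plane × Plane)} (hγ : IsPlan ρ ρ₀ γ) : planCost γ ≠ ∞ :=
  (ENNReal.mul_lt_top (by simp) (hγ.lintegral_sq_lt_top hρ hρ₀)).ne

lemma IsPlan.integrable_sq {ρ ρ₀ : Measure Plane} (hρ : IsP2 ρ) (hρ₀ : IsP2 ρ₀)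
    {γ : Measure (Plane × Plane)} (hγ : IsPlan ρ ρ₀ γ) :
    Integrable (fun p => ‖p.1 - p.2‖ ^ 2) γ :=
  ⟨by fun_prop, by simpa [HasFiniteIntegral] using hγ.lintegral_sq_lt_top hρ hρ₀⟩

lemma toReal_planCost (γ : Measure (Plane × Plane)) :
    (planCost γ).toReal = 2⁻¹ * ∫ p, ‖p.1 - p.2‖ ^ 2 ∂γ := by
  rw [planCost, ENNReal.toReal_mul,
    integral_eq_lintegral_of_nonneg_ae (.of_forall fun _ => by positivity) (by fun_prop)]
  simp [ENNReal.ofReal_pow]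

lemma isPlan_prod {ρ ρ₀ : Measure Plane} [IsProbabilityMeasure ρ] [IsProbabilityMeasure ρ₀] :
    IsPlan ρ ρ₀ (ρ.prod ρ₀) := by
  simp [IsPlan]

lemma wassersteinSq_le {ρ ρ₀ : Measure Plane} {γ : Measure (Plane × Plane)}
    (hγ : IsPlan ρ ρ₀ γ) : wassersteinSq ρ ρ₀ ≤ planCost γ :=
  iInf₂_le γ hγ

lemma wassersteinSq_ne_top {ρ ρ₀ : Measure Plane} (hρ : IsP2 ρ) (hρ₀ : IsP2 ρ₀) :
    wassersteinSq ρ ρ₀ ≠ ∞ := by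
  have := hρ.1
  have := hρ₀.1
  exact ne_top_of_le_ne_top (isPlan_prod.planCost_ne_top hρ hρ₀) (wassersteinSq_le isPlan_prod)

lemma exists_isPlan_planCost_le {ρ ρ₀ : Measure Plane} (hρ : IsP2 ρ) (hρ₀ : IsP2 ρ₀) {ε : ℝ}
    (hε : 0 < ε) :
    ∃ γ, IsPlan ρ ρ₀ γ ∧ planCost γ ≤ wassersteinSq ρ ρ₀ + ENNReal.ofReal ε := by
  have h : wassersteinSq ρ ρ₀ < wassersteinSq ρ ρ₀ + ENNReal.ofReal ε :=
    ENNReal.lt_add_right (wassersteinSq_ne_top hρ hρ₀) (by simpa using hε)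
  conv_lhs at h => rw [wassersteinSq]
  simp only [iInf_lt_iff] at h
  obtain ⟨γ, hγ, h⟩ := h
  exact ⟨γ, hγ, h.le⟩

/-! ### The logarithmic energy as a real integral -/

/-- Finiteness of the integral of |F| makes F finite almost everywhere, so passing to real values
loses nothing. -/
lemma integrable_toReal_and_eintegral_eq {α : Type*} [MeasurableSpace α] {μ : Measure α}
    {F : α → EReal} (hF : Measurable F)
    (h : ∫⁻ a, ((F a).toENNReal + (-F a).toENNReal) ∂μ ≠ ∞) :
    Integrable (fun a => (F a).toReal) μ ∧
      eintegral μ F = ((∫ a, (F a).toReal ∂μ : ℝ) : EReal) := by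
  have hm : Measurable fun a => (F a).toENNReal := by fun_prop
  have hm' : Measurable fun a => (-F a).toENNReal := by fun_prop
  have hae : ∀ᵐ a ∂μ, F a ≠ ⊤ ∧ F a ≠ ⊥ := by
    filter_upwards [ae_lt_top (by fun_prop) h] with a ha
    rw [ENNReal.add_lt_top] at ha
    constructor
    · simpa [EReal.toENNReal_eq_top_iff] using ha.1.ne
    · simpa [EReal.toENNReal_eq_top_iff, EReal.neg_eq_top_iff] using ha.2.ne
  have h1 : ∀ᵐ a ∂μ, (F a).toENNReal = ENNReal.ofReal (F a).toReal := by
    filter_upwards [hae] with a ha using EReal.toENNReal_of_ne_top ha.1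
  have h2 : ∀ᵐ a ∂μ, (-F a).toENNReal = ENNReal.ofReal (-(F a).toReal) := by
    filter_upwards [hae] with a ha
    rw [EReal.toENNReal_of_ne_top (by simpa [EReal.neg_eq_top_iff] using ha.2), EReal.toReal_neg_eq]
  have hint : Integrable (fun a => (F a).toReal) μ := by
    refine ⟨hF.ereal_toReal.aestronglyMeasurable, lt_of_le_of_lt (lintegral_mono_ae ?_) (lt_top_iff_ne_top.2 h)⟩
    filter_upwards [h1, h2] with a h1 h2
    rw [h1, h2, ← ofReal_norm, Real.norm_eq_abs]
    rcases le_total 0 (F a).toReal with h | h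
    · rw [abs_of_nonneg h]; exact le_self_add
    · rw [abs_of_nonpos h]; exact le_add_self
  refine ⟨hint, ?_⟩
  rw [lintegral_add_left hm, ENNReal.add_ne_top] at h
  rw [eintegral, integral_eq_lintegral_pos_part_sub_lintegral_neg_part hint, ← lintegral_congr_ae h1,
    ← lintegral_congr_ae h2, EReal.coe_sub, EReal.coe_ennreal_toReal h.1,
    EReal.coe_ennreal_toReal h.2]

lemma toReal_logKernel (z : Plane) : (logKernel z).toReal = -Real.log ‖z‖ := by
  rcases eq_or_ne z 0 with rfl | hz
  · simp [logKernel]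
  · rw [logKernel_of_ne_zero hz, EReal.toReal_coe]

/-- Absolute convergence of the mutual logarithmic energy. -/
def FinEnergy (μ ν : Measure Plane) : Prop := ∫⁻ p, kerAbs (p.1 - p.2) ∂(μ.prod ν) ≠ ∞

/-- The mutual logarithmic energy. -/
def logPair (μ ν : Measure Plane) : ℝ := ∫ p, -Real.log ‖p.1 - p.2‖ ∂(μ.prod ν)

lemma FinEnergy.integrable {μ ν : Measure Plane} (h : FinEnergy μ ν) :
    Integrable (fun p : Plane × Plane => -Real.log ‖p.1 - p.2‖) (μ.prod ν) := by
  simpa only [toReal_logKernel] using (integrable_toReal_and_eintegral_eq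
    (F := fun p : Plane × Plane => logKernel (p.1 - p.2)) (by fun_prop) h).1

lemma FinEnergy.logEnergy_eq {μ : Measure Plane} (h : FinEnergy μ μ) :
    logEnergy μ = (logPair μ μ : EReal) := by
  rw [logEnergy, (integrable_toReal_and_eintegral_eq
    (F := fun p : Plane × Plane => logKernel (p.1 - p.2)) (by fun_prop) h).2]
  simp only [toReal_logKernel, logPair]

lemma FinEnergy.ae_ne {μ ν : Measure Plane} (h : FinEnergy μ ν) :
    ∀ᵐ p ∂(μ.prod ν), p.1 ≠ p.2 := by
  filter_upwards [ae_lt_top (by fun_prop) h] with p hp hpp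
  simp [hpp] at hp

lemma logPotential_eq {ρ : Measure Plane} {x : Plane} (h : ∫⁻ y, kerAbs (x - y) ∂ρ ≠ ∞) :
    Integrable (fun y => -Real.log ‖x - y‖) ρ ∧
      logPotential ρ x = ((∫ y, -Real.log ‖x - y‖ ∂ρ : ℝ) : EReal) := by
  have := integrable_toReal_and_eintegral_eq
    (F := fun y : Plane => logKernel (x - y)) (by fun_prop) h
  simp only [toReal_logKernel] at this
  exact this

lemma FinEnergy.symm {μ ν : Measure Plane} [SFinite μ] [SFinite ν] (h : FinEnergy μ ν) :
    FinEnergy ν μ := by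
  rw [FinEnergy, ← lintegral_prod_swap]
  have : ∀ p : Plane × Plane, kerAbs (p.swap.1 - p.swap.2) = kerAbs (p.1 - p.2) := fun p => by
    rw [← kerAbs_neg, neg_sub, Prod.fst_swap, Prod.snd_swap]
  simp only [this]
  exact h

lemma logPair_comm (μ ν : Measure Plane) [SFinite μ] [SFinite ν] :
    logPair μ ν = logPair ν μ := by
  rw [logPair, ← integral_prod_swap]
  simp only [Prod.fst_swap, Prod.snd_swap, norm_sub_rev]
  rfl

/-- The mixture `(1 - s) μ + s ν`. -/
def mixture {α : Type*} [MeasurableSpace α] (s : ℝ) (μ ν : Measure α) : Measure α :=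
  ENNReal.ofReal (1 - s) • μ + ENNReal.ofReal s • ν

instance {α : Type*} [MeasurableSpace α] (s : ℝ) (μ ν : Measure α) [IsFiniteMeasure μ]
    [IsFiniteMeasure ν] : IsFiniteMeasure (mixture s μ ν) := by
  have := Measure.smul_finite μ (ENNReal.ofReal_ne_top (r := 1 - s))
  have := Measure.smul_finite ν (ENNReal.ofReal_ne_top (r := s))
  unfold mixture
  infer_instance

lemma mixture_prod {μ ν κ : Measure Plane} [IsFiniteMeasure μ] [IsFiniteMeasure ν]
    [IsFiniteMeasure κ] (s : ℝ) :
    (mixture s μ ν).prod κ = mixture s (μ.prod κ) (ν.prod κ) := by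
  have := Measure.smul_finite μ (ENNReal.ofReal_ne_top (r := 1 - s))
  have := Measure.smul_finite ν (ENNReal.ofReal_ne_top (r := s))
  rw [mixture, Measure.add_prod, Measure.prod_smul_left, Measure.prod_smul_left, mixture]

lemma lintegral_mixture {α : Type*} [MeasurableSpace α] (s : ℝ) (μ ν : Measure α)
    (f : α → ℝ≥0∞) :
    ∫⁻ a, f a ∂(mixture s μ ν) =
      ENNReal.ofReal (1 - s) * ∫⁻ a, f a ∂μ + ENNReal.ofReal s * ∫⁻ a, f a ∂ν := by
  rw [mixture, lintegral_add_measure, lintegral_smul_measure, lintegral_smul_measure]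
  rfl

lemma FinEnergy.mixture {μ ν κ : Measure Plane} [IsFiniteMeasure μ] [IsFiniteMeasure ν]
    [IsFiniteMeasure κ] (hμ : FinEnergy μ κ) (hν : FinEnergy ν κ) (s : ℝ) :
    FinEnergy (mixture s μ ν) κ := by
  rw [FinEnergy, mixture_prod, lintegral_mixture]
  exact ENNReal.add_ne_top.2 ⟨ENNReal.mul_ne_top ENNReal.ofReal_ne_top hμ,
    ENNReal.mul_ne_top ENNReal.ofReal_ne_top hν⟩

lemma logPair_mixture {μ ν κ : Measure Plane} [IsFiniteMeasure μ] [IsFiniteMeasure ν]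
    [IsFiniteMeasure κ] (hμ : FinEnergy μ κ) (hν : FinEnergy ν κ) {s : ℝ} (h0 : 0 ≤ s)
    (h1 : s ≤ 1) :
    logPair (LogTransport.mixture s μ ν) κ = (1 - s) * logPair μ κ + s * logPair ν κ := by
  rw [logPair, mixture_prod, LogTransport.mixture, integral_add_measure
    (hμ.integrable.smul_measure ENNReal.ofReal_ne_top)
    (hν.integrable.smul_measure ENNReal.ofReal_ne_top), integral_smul_measure,
    integral_smul_measure, ENNReal.toReal_ofReal (by linarith), ENNReal.toReal_ofReal h0]
  rfl

lemma ofReal_one_sub_add {s : ℝ} (h0 : 0 ≤ s) (h1 : s ≤ 1) :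
    ENNReal.ofReal (1 - s) + ENNReal.ofReal s = 1 := by
  rw [← ENNReal.ofReal_add (by linarith) h0]
  simp

lemma IsP2.mixture {μ ν : Measure Plane} (hμ : IsP2 μ) (hν : IsP2 ν) {s : ℝ} (h0 : 0 ≤ s)
    (h1 : s ≤ 1) : IsP2 (mixture s μ ν) := by
  have := hμ.1
  have := hν.1
  constructor
  · constructor
    have := lintegral_mixture s μ ν (fun _ => 1)
    simpa [ofReal_one_sub_add h0 h1] using this
  · rw [lintegral_mixture]
    exact ENNReal.add_lt_top.2 ⟨ENNReal.mul_lt_top ENNReal.ofReal_lt_top hμ.2,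
      ENNReal.mul_lt_top ENNReal.ofReal_lt_top hν.2⟩

lemma IsPlan.mixture {ρ μ ρ₀ : Measure Plane} {γ γ' : Measure (Plane × Plane)}
    (hγ : IsPlan ρ ρ₀ γ) (hγ' : IsPlan μ ρ₀ γ') {s : ℝ} (h0 : 0 ≤ s) (h1 : s ≤ 1) :
    IsPlan (mixture s ρ μ) ρ₀ (mixture s γ γ') := by
  constructor
  · rw [LogTransport.mixture, Measure.map_add _ _ measurable_fst, Measure.map_smul,
      Measure.map_smul, hγ.1, hγ'.1, LogTransport.mixture]
  · rw [LogTransport.mixture, Measure.map_add _ _ measurable_snd, Measure.map_smul,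
      Measure.map_smul, hγ.2, hγ'.2, ← add_smul, ofReal_one_sub_add h0 h1, one_smul]

lemma planCost_mixture (s : ℝ) (γ γ' : Measure (Plane × Plane)) :
    planCost (mixture s γ γ') =
      ENNReal.ofReal (1 - s) * planCost γ + ENNReal.ofReal s * planCost γ' := by
  rw [planCost, lintegral_mixture, planCost, planCost]
  ring

lemma finEnergy_of_logEnergy_lt_top {μ : Measure Plane} (hμ : IsP2 μ) (h : logEnergy μ < ⊤) :
    FinEnergy μ μ := by
  have := hμ.1
  -- By log t ≤ t the negative part is controlled by first moments, so only the positive part could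
  -- diverge, and that would make the energy +∞.
  have hN : ∫⁻ p : Plane × Plane, (-logKernel (p.1 - p.2)).toENNReal ∂(μ.prod μ) ≠ ∞ := by
    refine ne_top_of_le_ne_top (b := ∫⁻ p : Plane × Plane, (‖p.1‖ₑ + ‖p.2‖ₑ) ∂(μ.prod μ)) ?_
      (lintegral_mono fun p => ?_)
    · rw [lintegral_add_left (by fun_prop),
        (isPlan_prod (ρ := μ) (ρ₀ := μ)).lintegral_fst (f := fun x => ‖x‖ₑ) (by fun_prop),
        (isPlan_prod (ρ := μ) (ρ₀ := μ)).lintegral_snd (f := fun x => ‖x‖ₑ) (by fun_prop)]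
      exact (ENNReal.add_lt_top.2
        ⟨hμ.lintegral_enorm_lt_top, hμ.lintegral_enorm_lt_top⟩).ne
    · rcases eq_or_ne (p.1 - p.2) 0 with h0 | h0
      · simp [h0, logKernel]
      · rw [logKernel_of_ne_zero h0, ← EReal.coe_neg, neg_neg, EReal.real_coe_toENNReal]
        refine le_trans ?_ (enorm_sub_le (a := p.1) (b := p.2))
        rw [← ofReal_norm]
        exact ENNReal.ofReal_le_ofReal (Real.log_le_self (norm_nonneg _))
  have hP : ∫⁻ p : Plane × Plane, (logKernel (p.1 - p.2)).toENNReal ∂(μ.prod μ) ≠ ∞ := by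
    intro hP
    rw [logEnergy, eintegral, hP, ← EReal.coe_ennreal_toReal hN] at h
    simp at h
  rw [FinEnergy]
  unfold kerAbs
  rw [lintegral_add_left (by fun_prop)]
  exact ENNReal.add_ne_top.2 ⟨hP, hN⟩

/-! ### The first variation at a minimizer -/

/-- Transport costs between measures with finite second moment are finite, so a single competitor of
finite energy suffices. -/
lemma IsMinimizer.finEnergy {ρ₀ ρ μ : Measure Plane} (hρ : IsMinimizer ρ₀ ρ) (hρ₀ : IsP2 ρ₀)
    (hμ : IsP2 μ) (hμμ : FinEnergy μ μ) : FinEnergy ρ ρ := by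
  refine finEnergy_of_logEnergy_lt_top hρ.1 (lt_top_iff_ne_top.2 fun h => ?_)
  have := hρ.2 μ hμ
  rw [energyJ, energyJ, h, hμμ.logEnergy_eq, ← EReal.coe_ennreal_toReal (wassersteinSq_ne_top hρ.1 hρ₀),
    ← EReal.coe_ennreal_toReal (wassersteinSq_ne_top hμ hρ₀), ← EReal.coe_add,
    EReal.top_add_coe, top_le_iff] at this
  exact EReal.coe_ne_top _ this

/-- The mixture of γ and γ' is admissible for the mixed measure, and its cost is affine in s.
Replacing the Wasserstein term of ρ by the cost of γ loses at most ε. -/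
theorem IsMinimizer.first_variation {ρ₀ ρ μ : Measure Plane} (hρ : IsMinimizer ρ₀ ρ)
    (hρ₀ : IsP2 ρ₀) (hρρ : FinEnergy ρ ρ) (hμ : IsP2 μ) (hμρ : FinEnergy μ ρ)
    (hμμ : FinEnergy μ μ) {γ γ' : Measure (Plane × Plane)} (hγ : IsPlan ρ ρ₀ γ)
    (hγ' : IsPlan μ ρ₀ γ') {ε : ℝ} (hε : 0 ≤ ε)
    (hopt : planCost γ ≤ wassersteinSq ρ ρ₀ + ENNReal.ofReal ε) {s : ℝ} (h0 : 0 ≤ s)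
    (h1 : s ≤ 1) :
    0 ≤ ε + s * (2 * (logPair μ ρ - logPair ρ ρ) +
        ((planCost γ').toReal - (planCost γ).toReal)) +
      s ^ 2 * (logPair ρ ρ - 2 * logPair μ ρ + logPair μ μ) := by
  have := hρ.1.1
  have := hμ.1
  have hm := hρ.1.mixture hμ h0 h1
  have := hm.1
  have hJ := hρ.2 _ hm
  have hle := wassersteinSq_le (hγ.mixture hγ' h0 h1)
  rw [planCost_mixture] at hle
  have hW := wassersteinSq_ne_top hρ.1 hρ₀
  have hc := hγ.planCost_ne_top hρ.1 hρ₀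
  have hc' := hγ'.planCost_ne_top hμ hρ₀
  have e1 := hρρ.mixture hμρ s
  have e2 := hμρ.symm.mixture hμμ s
  have e3 := e1.symm.mixture e2.symm s
  rw [energyJ, energyJ, hρρ.logEnergy_eq, e3.logEnergy_eq, ← EReal.coe_ennreal_toReal hW,
    ← EReal.coe_ennreal_toReal (wassersteinSq_ne_top hm hρ₀), ← EReal.coe_add, ← EReal.coe_add,
    EReal.coe_le_coe_iff] at hJ
  rw [logPair_mixture e1.symm e2.symm h0 h1, logPair_comm ρ (LogTransport.mixture s ρ μ),
    logPair_comm μ (LogTransport.mixture s ρ μ),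
    logPair_mixture hρρ hμρ h0 h1, logPair_mixture hμρ.symm hμμ h0 h1, logPair_comm ρ μ] at hJ
  have hle' := ENNReal.toReal_mono (by finiteness) hle
  rw [ENNReal.toReal_add (by finiteness) (by finiteness), ENNReal.toReal_mul, ENNReal.toReal_mul,
    ENNReal.toReal_ofReal (by linarith), ENNReal.toReal_ofReal h0] at hle'
  have hopt' := ENNReal.toReal_mono (by finiteness) hopt
  rw [ENNReal.toReal_add hW (by finiteness), ENNReal.toReal_ofReal hε] at hopt'
  nlinarith

/-! ### Smearing the first marginal of a plan over circles -/

/-- The image of a plan when the first point of `p` is moved to a uniformly distributed point of the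
circle of centre `a p` and radius `r p`. -/
def smearPlan (γ : Measure (Plane × Plane)) (a : Plane × Plane → Plane) (r : Plane × Plane → ℝ) :
    Measure (Plane × Plane) :=
  (γ.prod angleMeasure).map fun q => (a q.1 + r q.1 • direction q.2, q.1.2)

/-- The first marginal of `smearPlan γ a r`. -/
def smear (γ : Measure (Plane × Plane)) (a : Plane × Plane → Plane) (r : Plane × Plane → ℝ) :
    Measure Plane :=
  (γ.prod angleMeasure).map fun q => a q.1 + r q.1 • direction q.2

section Smear

variable {γ : Measure (Plane × Plane)} {a : Plane × Plane → Plane} {r : Plane × Plane → ℝ}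

lemma isPlan_smearPlan {ρ ρ₀ : Measure Plane} (hγ : IsPlan ρ ρ₀ γ) (ha : Measurable a)
    (hr : Measurable r) [IsProbabilityMeasure γ] : IsPlan (smear γ a r) ρ₀ (smearPlan γ a r) := by
  constructor
  · rw [smearPlan, Measure.map_map measurable_fst (by fun_prop), smear]
    rfl
  · rw [smearPlan, Measure.map_map measurable_snd (by fun_prop)]
    have : (Prod.snd ∘ fun q : (Plane × Plane) × ℝ => (a q.1 + r q.1 • direction q.2, q.1.2)) =
        Prod.snd ∘ Prod.fst := rfl
    rw [this, ← Measure.map_map measurable_snd measurable_fst, Measure.map_fst_prod, measure_univ,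
      one_smul, hγ.2]

lemma isP2_smear [IsProbabilityMeasure γ] (ha : Measurable a) (hr : Measurable r)
    (ha2 : ∫⁻ p, ‖a p‖ₑ ^ 2 ∂γ < ∞) {R : ℝ} (hR : ∀ p, |r p| ≤ R) : IsP2 (smear γ a r) := by
  constructor
  · exact Measure.isProbabilityMeasure_map (by fun_prop)
  rw [smear, lintegral_map (by fun_prop) (by fun_prop)]
  calc ∫⁻ q, ‖a q.1 + r q.1 • direction q.2‖ₑ ^ 2 ∂(γ.prod angleMeasure)
      ≤ ∫⁻ q, 2 * (‖a q.1‖ₑ ^ 2 + ENNReal.ofReal R ^ 2) ∂(γ.prod angleMeasure) := by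
        refine lintegral_mono fun q => (enorm_add_sq_le _ _).trans ?_
        gcongr
        rw [← ofReal_norm, norm_smul, norm_direction, mul_one]
        exact ENNReal.ofReal_le_ofReal (hR _)
    _ = ∫⁻ p, 2 * (‖a p‖ₑ ^ 2 + ENNReal.ofReal R ^ 2) ∂γ := by
        rw [lintegral_prod _ (by fun_prop)]
        simp
    _ < ∞ := by
        rw [lintegral_const_mul _ (by fun_prop), lintegral_add_right _ (by fun_prop)]
        exact ENNReal.mul_lt_top (by simp) (ENNReal.add_lt_top.2 ⟨ha2, by simp⟩)

lemma lintegral_kerAbs_smear_prod [SFinite γ] (ha : Measurable a) (hr : Measurable r) (ν : Measure Plane)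
    [SFinite ν] :
    ∫⁻ p, kerAbs (p.1 - p.2) ∂((smear γ a r).prod ν) =
      ∫⁻ p, ∫⁻ w, ∫⁻ θ, kerAbs (a p - w + r p • direction θ) ∂angleMeasure ∂ν ∂γ := by
  have : SFinite (smear γ a r) := by unfold smear; infer_instance
  rw [lintegral_prod _ (by fun_prop), smear, lintegral_map (by fun_prop) (by fun_prop),
    lintegral_prod _ (by fun_prop)]
  refine lintegral_congr fun p => ?_
  rw [lintegral_lintegral_swap (by fun_prop)]
  simp only [sub_add_eq_add_sub]

lemma finEnergy_smear_of_radius_ne_zero [IsProbabilityMeasure γ] (ha : Measurable a)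
    (ha2 : ∫⁻ p, ‖a p‖ₑ ∂γ < ∞) {t : ℝ} (ht : t ≠ 0) {ν : Measure Plane} (hν : IsP2 ν) :
    FinEnergy (smear γ a fun _ => t) ν := by
  have := hν.1
  rw [FinEnergy, lintegral_kerAbs_smear_prod ha (by fun_prop)]
  refine ne_top_of_le_ne_top (b := ∫⁻ p, ∫⁻ w, (ENNReal.ofReal (|Real.log (|t|)| + 2 * |t|) +
    2 * (‖a p‖ₑ + ‖w‖ₑ)) ∂ν ∂γ) ?_ (lintegral_mono fun p => lintegral_mono fun w => ?_)
  · have h := hν.lintegral_enorm_lt_top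
    have e : ∀ p, ∫⁻ w, (ENNReal.ofReal (|Real.log (|t|)| + 2 * |t|) + 2 * (‖a p‖ₑ + ‖w‖ₑ)) ∂ν =
        ENNReal.ofReal (|Real.log (|t|)| + 2 * |t|) + 2 * (‖a p‖ₑ + ∫⁻ w, ‖w‖ₑ ∂ν) := by
      intro p
      rw [lintegral_add_left (by fun_prop), lintegral_const_mul _ (by fun_prop),
        lintegral_add_left (by fun_prop)]
      simp
    simp_rw [e]
    rw [lintegral_add_left (by fun_prop), lintegral_const_mul _ (by fun_prop),
        lintegral_add_left' (by fun_prop)]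
    simp only [lintegral_const, measure_univ, mul_one]
    finiteness
  · refine (lintegral_kerAbs_le_of_radius_ne_zero _ ht).trans ?_
    have h1 := norm_sub_le (a p) w
    have h2 := neg_le_abs (Real.log (|t|))
    calc ENNReal.ofReal (-Real.log |t| + 2 * (‖a p - w‖ + |t|))
        ≤ ENNReal.ofReal ((|Real.log (|t|)| + 2 * |t|) + 2 * (‖a p‖ + ‖w‖)) :=
          ENNReal.ofReal_le_ofReal (by linarith)
      _ = _ := by
          rw [ENNReal.ofReal_add (by positivity) (by positivity), ENNReal.ofReal_mul zero_le_two,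
            ENNReal.ofReal_add (norm_nonneg _) (norm_nonneg _)]
          simp

lemma finEnergy_smear_of_finEnergy_map [IsProbabilityMeasure γ] (ha : Measurable a)
    (hr : Measurable r) (ha2 : ∫⁻ p, ‖a p‖ₑ ∂γ < ∞) {R : ℝ} (hR : ∀ p, |r p| ≤ R)
    {ν : Measure Plane} (hν : IsP2 ν) (h : FinEnergy (γ.map a) ν) :
    FinEnergy (smear γ a r) ν := by
  have := hν.1
  rw [FinEnergy, lintegral_prod _ (by fun_prop), lintegral_map (by fun_prop) ha] at h
  rw [FinEnergy, lintegral_kerAbs_smear_prod ha (by fun_prop)]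
  refine ne_top_of_le_ne_top (b := ∫⁻ p, ∫⁻ w, (kerAbs (a p - w) + (2 * ENNReal.ofReal R +
    2 * (‖a p‖ₑ + ‖w‖ₑ))) ∂ν ∂γ) ?_ (lintegral_mono fun p => lintegral_mono fun w => ?_)
  · have h' := hν.lintegral_enorm_lt_top
    have e : ∀ p, ∫⁻ w, (kerAbs (a p - w) + (2 * ENNReal.ofReal R +
        2 * (‖a p‖ₑ + ‖w‖ₑ))) ∂ν = ∫⁻ w, kerAbs (a p - w) ∂ν +
        (2 * ENNReal.ofReal R + 2 * (‖a p‖ₑ + ∫⁻ w, ‖w‖ₑ ∂ν)) := by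
      intro p
      rw [lintegral_add_left (by fun_prop), lintegral_add_left (by fun_prop),
        lintegral_const_mul 2 (f := fun w => ‖a p‖ₑ + ‖w‖ₑ) (by fun_prop),
        lintegral_add_left (by fun_prop)]
      simp
    simp_rw [e]
    rw [lintegral_add_right _ (by fun_prop), lintegral_add_left (by fun_prop),
      lintegral_const_mul 2 (f := fun p => ‖a p‖ₑ + ∫⁻ w, ‖w‖ₑ ∂ν) (by fun_prop), lintegral_add_left' (by fun_prop)]
    simp only [lintegral_const, measure_univ, mul_one]
    finiteness
  · refine (lintegral_kerAbs_le_kerAbs_add _ _).trans ?_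
    gcongr
    have h1 := norm_sub_le (a p) w
    calc ENNReal.ofReal (2 * (‖a p - w‖ + |r p|))
        ≤ ENNReal.ofReal (2 * R + 2 * (‖a p‖ + ‖w‖)) :=
          ENNReal.ofReal_le_ofReal (by linarith [hR p])
      _ = _ := by
          have := (abs_nonneg _).trans (hR p)
          rw [ENNReal.ofReal_add (by positivity) (by positivity), ENNReal.ofReal_mul zero_le_two,
            ENNReal.ofReal_mul zero_le_two, ENNReal.ofReal_add (norm_nonneg _) (norm_nonneg _)]
          simp

/-- The cross term between displacement and direction averages to zero, so spreading contributes
only its own variance, whatever the plan. -/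
lemma toReal_planCost_smearPlan [IsProbabilityMeasure γ] (ha : Measurable a) (hr : Measurable r)
    (hint : Integrable (fun p => ‖a p - p.2‖ ^ 2) γ) {R : ℝ} (hR : ∀ p, |r p| ≤ R) :
    (planCost (smearPlan γ a r)).toReal =
      2⁻¹ * (∫ p, ‖a p - p.2‖ ^ 2 ∂γ + ∫ p, r p ^ 2 ∂γ) := by
  have hR0 : ∀ p, r p ^ 2 ≤ R ^ 2 := fun p => sq_le_sq' (by linarith [abs_le.1 (hR p)])
    (abs_le.1 (hR p)).2
  have hrint : Integrable (fun p => r p ^ 2) γ :=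
    Integrable.of_bound (C := R ^ 2) (by fun_prop)
      (.of_forall fun p => by rw [Real.norm_eq_abs, abs_of_nonneg (sq_nonneg _)]; exact hR0 p)
  have key : ∀ z : Plane, ∀ t : ℝ,
      ∫ θ, ‖z + t • direction θ‖ ^ 2 ∂angleMeasure = ‖z‖ ^ 2 + t ^ 2 := by
    intro z t
    have e : ∀ θ, ‖z + t • direction θ‖ ^ 2 =
        (‖z‖ ^ 2 + t ^ 2) + inner ℝ ((2 * t) • z) (direction θ) := by
      intro θ
      rw [norm_add_sq_real, norm_smul, norm_direction, inner_smul_right, inner_smul_left]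
      simp only [Real.norm_eq_abs, mul_one, sq_abs, conj_trivial]
      ring
    simp_rw [e]
    rw [integral_add (integrable_const _) (integrable_direction.const_inner _),
      integral_inner integrable_direction, integral_direction]
    simp
  rw [toReal_planCost, smearPlan, integral_map (by fun_prop) (by fun_prop), ← integral_add hint hrint,
    integral_prod]
  · congr 2
    ext p
    rw [← key]
    simp only [sub_add_eq_add_sub]
  · refine Integrable.mono' (g := fun q : (Plane × Plane) × ℝ => 2 * (‖a q.1 - q.1.2‖ ^ 2 + R ^ 2))
      ?_ (by fun_prop) (.of_forall fun q => ?_)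
    · exact Integrable.comp_fst ((hint.add (integrable_const _)).const_mul 2) _
    · simp only
      rw [Real.norm_eq_abs, abs_of_nonneg (by positivity), add_sub_right_comm]
      have h := norm_add_le (a q.1 - q.1.2) (r q.1 • direction q.2)
      rw [norm_smul, norm_direction, mul_one, Real.norm_eq_abs] at h
      have h2 := hR0 q.1
      rw [← sq_abs (r q.1)] at h2
      nlinarith [norm_nonneg (a q.1 - q.1.2 + r q.1 • direction q.2), abs_nonneg (r q.1),
        sq_nonneg (‖a q.1 - q.1.2‖ - |r q.1|), norm_nonneg (a q.1 - q.1.2)]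

lemma logPair_eq_integral_integral {μ ν : Measure Plane} [SFinite μ] [SFinite ν]
    (h : FinEnergy μ ν) :
    Integrable (fun x => ∫ w, -Real.log ‖x - w‖ ∂ν) μ ∧
      logPair μ ν = ∫ x, ∫ w, -Real.log ‖x - w‖ ∂ν ∂μ :=
  ⟨h.integrable.integral_prod_left, integral_prod _ h.integrable⟩

lemma logPair_smear [IsProbabilityMeasure γ] (ha : Measurable a) (hr : Measurable r)
    {ν : Measure Plane} [SFinite ν] (h : FinEnergy (smear γ a r) ν) :
    Integrable (fun q : (Plane × Plane) × ℝ =>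
        ∫ w, -Real.log ‖a q.1 + r q.1 • direction q.2 - w‖ ∂ν) (γ.prod angleMeasure) ∧
      logPair (smear γ a r) ν = ∫ p, ∫ θ, ∫ w,
        -Real.log ‖a p + r p • direction θ - w‖ ∂ν ∂angleMeasure ∂γ := by
  have : SFinite (smear γ a r) := by unfold smear; infer_instance
  obtain ⟨h1, h2⟩ := logPair_eq_integral_integral h
  have hm : AEMeasurable (fun q : (Plane × Plane) × ℝ => a q.1 + r q.1 • direction q.2)
    (γ.prod angleMeasure) := by fun_prop
  have h3 := (integrable_map_measure h1.aestronglyMeasurable hm).1 h1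
  refine ⟨h3, ?_⟩
  rw [h2, smear, integral_map hm h1.aestronglyMeasurable]
  exact integral_prod _ h3

/-- Fubini puts the circle mean innermost, where it is explicit. The exceptional p are those at
which the absolute integral diverges. -/
lemma integral_integral_smear_eq [IsProbabilityMeasure γ] (ha : Measurable a) (hr : Measurable r)
    {ν : Measure Plane} [SFinite ν] (h : FinEnergy (smear γ a r) ν) :
    ∀ᵐ p ∂γ, Integrable (fun w => -Real.log (max ‖a p - w‖ |r p|)) ν ∧
      ∫ θ, ∫ w, -Real.log ‖a p + r p • direction θ - w‖ ∂ν ∂angleMeasure =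
        ∫ w, -Real.log (max ‖a p - w‖ |r p|) ∂ν := by
  rw [FinEnergy, lintegral_kerAbs_smear_prod ha hr] at h
  filter_upwards [ae_lt_top (by fun_prop) h] with p hp
  have hi : Integrable (fun y : Plane × ℝ => -Real.log ‖a p + r p • direction y.2 - y.1‖)
      (ν.prod angleMeasure) := by
    refine ⟨(by fun_prop : Measurable _).aestronglyMeasurable, lt_of_le_of_lt ?_ hp⟩
    rw [← lintegral_prod (fun y : Plane × ℝ => kerAbs (a p - y.1 + r p • direction y.2))
      (by fun_prop)]
    refine lintegral_mono fun y => ?_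
    rw [sub_add_eq_add_sub]
    rcases eq_or_ne (a p + r p • direction y.2 - y.1) 0 with h0 | h0
    · simp [h0]
    · rw [kerAbs_of_ne_zero h0, enorm_neg, ← ofReal_norm, Real.norm_eq_abs]
  have e : ∀ w, ∫ θ, -Real.log ‖a p + r p • direction θ - w‖ ∂angleMeasure =
      -Real.log (max ‖a p - w‖ |r p|) := by
    intro w
    rw [integral_neg, ← integral_log_norm_add_smul_direction]
    simp only [sub_add_eq_add_sub]
  have h1 := hi.integral_prod_left
  simp only [e] at h1
  refine ⟨h1, ?_⟩
  rw [← integral_integral_swap (f := fun w θ => -Real.log ‖a p + r p • direction θ - w‖) hi]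
  simp only [e]

end Smear

/-! ### The density bound -/

lemma nonneg_of_forall_nonneg_add {B Q : ℝ}
    (h : ∀ ε > 0, ∀ s > 0, s ≤ 1 → 0 ≤ ε + s * B + s ^ 2 * Q) : 0 ≤ B := by
  by_contra! hB
  have hQ : 0 < |Q| + 1 := by positivity
  -- With this s the quadratic term is at most -sB/2. Taking ε = -sB/4 below leaves a total of at
  -- most sB/4 < 0.
  obtain ⟨s, hs0, hs1, hs⟩ : ∃ s > 0, s ≤ 1 ∧ s * (|Q| + 1) ≤ -B / 2 := by
    refine ⟨min 1 (-B / 2 / (|Q| + 1)), lt_min one_pos (by apply div_pos _ hQ; linarith),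
      min_le_left _ _, ?_⟩
    calc _ ≤ -B / 2 / (|Q| + 1) * (|Q| + 1) := by gcongr; exact min_le_right _ _
      _ = _ := div_mul_cancel₀ _ hQ.ne'
  have h1 := h (s * (-B) / 4) (by nlinarith) s hs0 hs1
  have h2 : s * Q ≤ -B / 2 := by nlinarith [le_abs_self Q]
  nlinarith

/-- When the radius depends on the first point only, the spread measure is the same for all plans,
so μ can be fixed before ε and the plan are chosen. -/
lemma smear_fst_eq {ρ ρ₀ : Measure Plane} [IsProbabilityMeasure ρ] {γ : Measure (Plane × Plane)}
    (hγ : IsPlan ρ ρ₀ γ) {r : Plane → ℝ} (hr : Measurable r) :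
    smear γ Prod.fst (fun p => r p.1) =
      (ρ.prod angleMeasure).map fun q => q.1 + r q.1 • direction q.2 := by
  have := hγ.isProbabilityMeasure
  have h : ρ.prod angleMeasure = (γ.prod angleMeasure).map (Prod.map Prod.fst id) := by
    rw [← Measure.map_prod_map _ _ measurable_fst measurable_id, Measure.map_id, hγ.1]
  rw [h, Measure.map_map (by fun_prop) (by fun_prop), smear]
  rfl

lemma IsP2.lintegral_fst_lt_top {ρ ρ₀ : Measure Plane} (hρ : IsP2 ρ)
    {γ : Measure (Plane × Plane)} (hγ : IsPlan ρ ρ₀ γ) : ∫⁻ p, ‖p.1‖ₑ ∂γ < ∞ := by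
  rw [hγ.lintegral_fst (f := fun x => ‖x‖ₑ) (by fun_prop)]
  exact hρ.lintegral_enorm_lt_top

lemma IsP2.lintegral_fst_sq_lt_top {ρ ρ₀ : Measure Plane} (hρ : IsP2 ρ)
    {γ : Measure (Plane × Plane)} (hγ : IsPlan ρ ρ₀ γ) : ∫⁻ p, ‖p.1‖ₑ ^ 2 ∂γ < ∞ := by
  rw [hγ.lintegral_fst (f := fun x => ‖x‖ₑ ^ 2) (by fun_prop)]
  exact hρ.2

/-- The competitor is ρ spread over unit circles. -/
lemma IsMinimizer.finEnergy_self {ρ₀ ρ : Measure Plane} (hρ : IsMinimizer ρ₀ ρ)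
    (hρ₀ : IsP2 ρ₀) : FinEnergy ρ ρ := by
  have := hρ.1.1
  have := hρ₀.1
  have hγ : IsPlan ρ ρ₀ (ρ.prod ρ₀) := isPlan_prod
  have hμ : IsP2 (smear (ρ.prod ρ₀) Prod.fst fun _ => 1) :=
    isP2_smear measurable_fst measurable_const (hρ.1.lintegral_fst_sq_lt_top hγ) (R := 1) (by simp)
  exact hρ.finEnergy hρ₀ hμ (finEnergy_smear_of_radius_ne_zero measurable_fst
    (hρ.1.lintegral_fst_lt_top hγ) one_ne_zero hμ)

lemma measurable_measure_closedBall (ρ : Measure Plane) [SFinite ρ] (t : ℝ) :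
    Measurable fun x => ρ (Metric.closedBall x t) := by
  have : MeasurableSet {p : Plane × Plane | dist p.2 p.1 ≤ t} :=
    measurableSet_le (by fun_prop) (by fun_prop)
  exact measurable_measure_prodMk_left this

lemma IsPlan.integrable_comp_fst {ρ ρ₀ : Measure Plane} {γ : Measure (Plane × Plane)}
    (hγ : IsPlan ρ ρ₀ γ) {f : Plane → ℝ} (hf : Integrable f ρ) :
    Integrable (fun p => f p.1) γ := by
  rw [← hγ.1] at hf
  exact hf.comp_measurable measurable_fst

lemma IsPlan.integral_comp_fst {ρ ρ₀ : Measure Plane} {γ : Measure (Plane × Plane)}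
    (hγ : IsPlan ρ ρ₀ γ) {f : Plane → ℝ} (hf : AEStronglyMeasurable f ρ) :
    ∫ p, f p.1 ∂γ = ∫ x, f x ∂ρ := by
  rw [← hγ.1] at hf ⊢
  rw [integral_map (by fun_prop) hf]

/-- Moving the points of a set to the circles of radius `t` around them decreases the energy. -/
lemma le_logPair_sub_logPair_smear {ρ ρ₀ : Measure Plane} (hρ : IsP2 ρ) (hE : FinEnergy ρ ρ)
    {γ : Measure (Plane × Plane)} (hγ : IsPlan ρ ρ₀ γ) {A : Set Plane} (hA : MeasurableSet A)
    {t : ℝ} (ht : 0 < t)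
    (hμρ : FinEnergy (smear γ Prod.fst fun p => A.indicator (fun _ => t) p.1) ρ) :
    ∫ x, A.indicator (fun x => Real.log 2 * ρ.real (Metric.closedBall x (t / 2))) x ∂ρ ≤
      logPair ρ ρ - logPair (smear γ Prod.fst fun p => A.indicator (fun _ => t) p.1) ρ := by
  have := hρ.1
  have := hγ.isProbabilityMeasure
  have hr : Measurable fun x => A.indicator (fun _ => t) x := measurable_const.indicator hA
  have hrp : Measurable fun p : Plane × Plane => A.indicator (fun _ => t) p.1 :=
    hr.comp measurable_fst
  obtain ⟨hU, hUE⟩ := logPair_eq_integral_integral hE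
  obtain ⟨hG, hGE⟩ := logPair_smear measurable_fst hrp hμρ
  have hGae := integral_integral_smear_eq measurable_fst hrp hμρ
  have hmeas : Measurable fun x => A.indicator
      (fun x => Real.log 2 * ρ.real (Metric.closedBall x (t / 2))) x :=
    ((measurable_measure_closedBall ρ (t / 2)).ennreal_toReal.const_mul _).indicator hA
  have hlog : 0 < Real.log 2 := Real.log_pos one_lt_two
  have hint : Integrable (fun x => A.indicator
      (fun x => Real.log 2 * ρ.real (Metric.closedBall x (t / 2))) x) ρ := by
    refine Integrable.of_bound (C := Real.log 2) hmeas.aestronglyMeasurable (.of_forall fun x => ?_)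
    by_cases hx : x ∈ A
    · rw [Set.indicator_of_mem hx, Real.norm_eq_abs, abs_of_nonneg (by positivity)]
      exact mul_le_of_le_one_right hlog.le measureReal_le_one
    · rw [Set.indicator_of_notMem hx, norm_zero]
      exact hlog.le
  rw [hUE, hGE, ← hγ.integral_comp_fst hU.1, ← integral_sub (hγ.integrable_comp_fst hU)
    hG.integral_prod_left, ← hγ.integral_comp_fst hint.1]
  refine integral_mono_ae (hγ.integrable_comp_fst hint) ((hγ.integrable_comp_fst hU).sub
    hG.integral_prod_left) ?_
  have hne : ∀ᵐ p ∂γ, ∀ᵐ w ∂ρ, p.1 ≠ w := by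
    have h := Measure.ae_ae_of_ae_prod hE.ae_ne
    rw [← hγ.1] at h
    have := ae_of_ae_map (by fun_prop) h
    rwa [hγ.1] at this
  have hUi : ∀ᵐ p ∂γ, Integrable (fun w => -Real.log ‖p.1 - w‖) ρ := by
    have h := hE.integrable.prod_right_ae
    rw [← hγ.1] at h
    have := ae_of_ae_map (by fun_prop) h
    rwa [hγ.1] at this
  filter_upwards [hGae, hne, hUi] with p hp hne hUi
  rw [hp.2, ← integral_sub hUi hp.1]
  by_cases hx : p.1 ∈ A
  · rw [Set.indicator_of_mem hx, mul_comm, ← smul_eq_mul,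
      ← integral_indicator_const _ Metric.isClosed_closedBall.measurableSet]
    refine integral_mono_ae (Integrable.indicator (integrable_const _)
      Metric.isClosed_closedBall.measurableSet) (hUi.sub hp.1) ?_
    filter_upwards [hne] with w hw
    have h0 : 0 < ‖p.1 - w‖ := norm_pos_iff.2 (sub_ne_zero.2 hw)
    simp only [Set.indicator_of_mem hx, abs_of_pos ht]
    -- Replacing |x-w| by max(|x-w|, t) gains at least log 2 where 2|x-w| ≤ t, and is never a loss
    -- elsewhere.
    by_cases hwb : w ∈ Metric.closedBall p.1 (t / 2)
    · rw [Set.indicator_of_mem hwb]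
      rw [Metric.mem_closedBall, dist_comm, dist_eq_norm] at hwb
      have h1 : Real.log (2 * ‖p.1 - w‖) ≤ Real.log (max ‖p.1 - w‖ t) :=
        Real.log_le_log (by positivity) (le_trans (by linarith) (le_max_right _ _))
      rw [Real.log_mul two_ne_zero h0.ne'] at h1
      linarith
    · rw [Set.indicator_of_notMem hwb]
      have := Real.log_le_log h0 (le_max_left ‖p.1 - w‖ t)
      linarith
  · simp [Set.indicator_of_notMem hx]

/-- The threshold is the break-even mass m with 2 log 2 · m = t²/2. Spreading exactly the points
above it gains strictly more energy than it costs, so there are almost none. -/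
lemma IsMinimizer.ae_measure_closedBall_le {ρ₀ ρ : Measure Plane} (hρ : IsMinimizer ρ₀ ρ)
    (hρ₀ : IsP2 ρ₀) {t : ℝ} (ht : 0 < t) :
    ∀ᵐ x ∂ρ, ρ.real (Metric.closedBall x (t / 2)) ≤ t ^ 2 / (4 * Real.log 2) := by
  have := hρ.1.1
  have := hρ₀.1
  have hE := hρ.finEnergy_self hρ₀
  have hlog : 0 < Real.log 2 := Real.log_pos one_lt_two
  set A := {x | t ^ 2 / (4 * Real.log 2) < ρ.real (Metric.closedBall x (t / 2))} with hAdef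
  have hmb : Measurable fun x => ρ.real (Metric.closedBall x (t / 2)) :=
    (measurable_measure_closedBall ρ (t / 2)).ennreal_toReal
  have hA : MeasurableSet A := measurableSet_lt measurable_const hmb
  set r : Plane → ℝ := A.indicator fun _ => t with hrdef
  have hr : Measurable r := measurable_const.indicator hA
  have hr1 : ∀ x, |r x| ≤ t := fun x => by
    by_cases hx : x ∈ A <;> simp [r, hx, ht.le, abs_of_pos ht]
  have hrp : Measurable fun p : Plane × Plane => r p.1 := by fun_prop
  set μ := (ρ.prod angleMeasure).map fun q => q.1 + r q.1 • direction q.2 with hμdef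
  have hγ₀ : IsPlan ρ ρ₀ (ρ.prod ρ₀) := isPlan_prod
  have hs₀ := smear_fst_eq hγ₀ hr
  have hμ : IsP2 μ := by
    rw [hμdef, ← hs₀]
    exact isP2_smear measurable_fst hrp (hρ.1.lintegral_fst_sq_lt_top hγ₀) fun p => hr1 p.1
  have hμE : ∀ {ν}, IsP2 ν → FinEnergy ρ ν → FinEnergy μ ν := fun {ν} hν h => by
    rw [hμdef, ← hs₀]
    refine finEnergy_smear_of_finEnergy_map measurable_fst hrp (hρ.1.lintegral_fst_lt_top hγ₀)
      (fun p => hr1 p.1) hν ?_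
    rwa [hγ₀.1]
  have hμρ := hμE hρ.1 hE
  have := hμ.1
  have hμμ := hμE hμ hμρ.symm
  have hD := le_logPair_sub_logPair_smear hρ.1 hE hγ₀ hA ht (by
    rw [← hrdef, hs₀]; exact hμρ)
  rw [← hrdef, hs₀, ← hμdef] at hD
  have hri : Integrable (fun x => r x ^ 2) ρ :=
    Integrable.of_bound (C := t ^ 2) (by fun_prop) (.of_forall fun x => by
      rw [norm_pow, Real.norm_eq_abs]; exact pow_le_pow_left₀ (abs_nonneg _) (hr1 x) 2)
  have hB : 0 ≤ 2 * (logPair μ ρ - logPair ρ ρ) + 2⁻¹ * ∫ x, r x ^ 2 ∂ρ := by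
    refine nonneg_of_forall_nonneg_add (Q := logPair ρ ρ - 2 * logPair μ ρ + logPair μ μ)
      fun ε hε s hs0 hs1 => ?_
    obtain ⟨γ, hγ, hopt⟩ := exists_isPlan_planCost_le hρ.1 hρ₀ hε
    have := hγ.isProbabilityMeasure
    have hγ' := isPlan_smearPlan hγ measurable_fst hrp
    rw [smear_fst_eq hγ hr] at hγ'
    have h := hρ.first_variation hρ₀ hE hμ hμρ hμμ hγ hγ' hε.le hopt hs0.le hs1
    rw [toReal_planCost_smearPlan measurable_fst hrp (hγ.integrable_sq hρ.1 hρ₀)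
      fun p => hr1 p.1, toReal_planCost, hγ.integral_comp_fst (f := fun x => r x ^ 2) hri.1] at h
    linarith
  have hg : ∀ x, r x ^ 2 = A.indicator (fun _ => t ^ 2) x := fun x => by
    by_cases hx : x ∈ A <;> simp [r, hx]
  have hi1 : Integrable (fun x => A.indicator
      (fun x => Real.log 2 * ρ.real (Metric.closedBall x (t / 2))) x) ρ := by
    refine Integrable.indicator (Integrable.of_bound (C := Real.log 2)
      (hmb.const_mul _).aestronglyMeasurable (.of_forall fun x => ?_)) hA
    rw [Real.norm_eq_abs, abs_of_nonneg (by positivity)]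
    exact mul_le_of_le_one_right hlog.le measureReal_le_one
  have hle : ∫ x, (2 * A.indicator
      (fun x => Real.log 2 * ρ.real (Metric.closedBall x (t / 2))) x - 2⁻¹ * r x ^ 2) ∂ρ ≤ 0 := by
    rw [integral_sub (hi1.const_mul 2) (hri.const_mul _), integral_const_mul, integral_const_mul]
    linarith
  have hpos : ∀ x, x ∈ A → 0 < 2 * A.indicator
      (fun x => Real.log 2 * ρ.real (Metric.closedBall x (t / 2))) x - 2⁻¹ * r x ^ 2 := by
    intro x hx
    have hx' := hx
    rw [hAdef, Set.mem_ofPred_eq, div_lt_iff₀ (by positivity)] at hx'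
    rw [hg, Set.indicator_of_mem hx, Set.indicator_of_mem hx]
    linarith
  have hnn : ∀ x, 0 ≤ 2 * A.indicator
      (fun x => Real.log 2 * ρ.real (Metric.closedBall x (t / 2))) x - 2⁻¹ * r x ^ 2 := by
    intro x
    by_cases hx : x ∈ A
    · exact (hpos x hx).le
    · simp [hg, hx]
  have h0 := (integral_eq_zero_iff_of_nonneg hnn ((hi1.const_mul 2).sub (hri.const_mul _))).1
    (le_antisymm hle (integral_nonneg hnn))
  filter_upwards [h0] with x hx
  by_contra! hx'
  exact (hpos x hx').ne' hx

/-- A disc of radius t/2 has area πt²/4, so the ball estimate says that its mean density is at most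
1/(π log 2). -/
theorem IsMinimizer.le_smul_volume {ρ₀ ρ : Measure Plane} (hρ : IsMinimizer ρ₀ ρ)
    (hρ₀ : IsP2 ρ₀) :
    ρ ≤ ENNReal.ofReal ((Real.pi * Real.log 2)⁻¹) • (volume : Measure Plane) := by
  have := hρ.1.1
  have hlog : 0 < Real.log 2 := Real.log_pos one_lt_two
  -- The null set depends on the radius, so only countably many radii are used. Differentiation
  -- needs just a sequence of radii tending to zero.
  have hae : ∀ᵐ x ∂ρ, ∀ n : ℕ, ρ.real (Metric.closedBall x ((1 / 2 : ℝ) ^ n / 2)) ≤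
      ((1 / 2 : ℝ) ^ n) ^ 2 / (4 * Real.log 2) :=
    ae_all_iff.2 fun n => hρ.ae_measure_closedBall_le hρ₀ (by positivity)
  set S := {x | ∀ n : ℕ, ρ.real (Metric.closedBall x ((1 / 2 : ℝ) ^ n / 2)) ≤
      ((1 / 2 : ℝ) ^ n) ^ 2 / (4 * Real.log 2)}
  have hloc : IsLocallyFiniteMeasure
      (ENNReal.ofReal ((Real.pi * Real.log 2)⁻¹) • (volume : Measure Plane)) :=
    ⟨fun x => ⟨Metric.ball x 1, Metric.ball_mem_nhds x one_pos,
      ENNReal.mul_lt_top ENNReal.ofReal_lt_top measure_ball_lt_top⟩⟩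
  refine Measure.le_iff.2 fun s _ => ?_
  have h1 : ρ s = ρ (s ∩ S) := by
    refine (measure_inter_conull ?_).symm
    exact hae
  rw [h1]
  refine le_trans ?_ (measure_mono (Set.inter_subset_left (t := S)))
  refine (Besicovitch.vitaliFamily ρ).measure_le_of_frequently_le _ .rfl _ fun x hx => ?_
  have ht : Filter.Tendsto (fun n : ℕ => (1 / 2 : ℝ) ^ n / 2) Filter.atTop
      (nhdsWithin 0 (Set.Ioi 0)) := by
    refine tendsto_nhdsWithin_iff.2 ⟨?_, .of_forall fun n => by
      simp only [Set.mem_Ioi]; positivity⟩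
    simpa using (tendsto_pow_atTop_nhds_zero_of_lt_one (r := (1 / 2 : ℝ)) (by norm_num)
      (by norm_num)).div_const 2
  refine ((Besicovitch.tendsto_filterAt ρ x).comp ht).frequently
    (Filter.Frequently.of_forall fun n => ?_)
  have h2 := hx.2 n
  simp only [Function.comp_apply, Measure.smul_apply, smul_eq_mul,
    EuclideanSpace.volume_closedBall_fin_two]
  rw [← ofReal_measureReal]
  set t : ℝ := (1 / 2 : ℝ) ^ n
  have ht0 : 0 < t := by positivity
  calc ENNReal.ofReal (ρ.real (Metric.closedBall x (t / 2)))
      ≤ ENNReal.ofReal ((Real.pi * Real.log 2)⁻¹ * ((t / 2) ^ 2 * Real.pi)) := by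
        refine ENNReal.ofReal_le_ofReal (h2.trans (le_of_eq ?_))
        field_simp
        ring
    _ = _ := by
        rw [ENNReal.ofReal_mul (by positivity), ENNReal.ofReal_mul (by positivity),
          ENNReal.ofReal_pow (by positivity)]

lemma exists_bounded_density {E : Type*} [MeasurableSpace E] {ν ρ : Measure E} [SigmaFinite ν]
    [IsFiniteMeasure ρ] {C : ℝ} (h : ρ ≤ ENNReal.ofReal C • ν) :
    ∃ f : E → ℝ, Measurable f ∧ (∀ x, 0 ≤ f x) ∧ MemLp f ∞ ν ∧
      ρ = ν.withDensity fun x => ENNReal.ofReal (f x) := by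
  have hac : ρ ≪ ν := (Measure.absolutelyContinuous_of_le h).trans
    Measure.smul_absolutelyContinuous
  have hd := Measure.withDensity_rnDeriv_eq ρ ν hac
  have hle : ρ.rnDeriv ν ≤ᵐ[ν] fun _ => ENNReal.ofReal C := by
    refine ae_le_of_forall_setLIntegral_le_of_sigmaFinite (by fun_prop) fun s hs _ => ?_
    rw [← withDensity_apply _ hs, hd]
    simpa using h s
  refine ⟨fun x => (ρ.rnDeriv ν x).toReal, by fun_prop, fun x => ENNReal.toReal_nonneg, ?_, ?_⟩
  · refine memLp_top_of_bound
      (Measure.measurable_rnDeriv ρ ν).ennreal_toReal.aestronglyMeasurable (ENNReal.ofReal C).toReal ?_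
    filter_upwards [hle] with x hx
    rw [Real.norm_eq_abs, abs_of_nonneg ENNReal.toReal_nonneg]
    exact ENNReal.toReal_mono ENNReal.ofReal_ne_top hx
  · conv_lhs => rw [← hd]
    refine withDensity_congr_ae ?_
    filter_upwards [Measure.rnDeriv_lt_top ρ ν] with x hx
    rw [ENNReal.ofReal_toReal hx.ne]

/-! ### Potentials of measures with bounded density -/

/-- A majorant, in terms of the distance `a` to the singularity, for the increment of the gradient
of the logarithm over a displacement of length `d`. -/
def incrementBound (d a : ℝ) : ℝ := d / (a * max a (d / 2))

/-- The modulus of log-Lipschitz continuity. -/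
def logModulus (d : ℝ) : ℝ := d * (1 + |Real.log d|)

/-- The gradient of the logarithm of the norm. -/
def logGrad (z : Plane) : Plane := (1 / ‖z‖) ^ 2 • z

@[fun_prop]
lemma measurable_incrementBound (d : ℝ) : Measurable (incrementBound d) := by
  unfold incrementBound
  fun_prop

@[fun_prop]
lemma measurable_logGrad : Measurable logGrad := by
  unfold logGrad
  fun_prop

lemma incrementBound_nonneg {d a : ℝ} (hd : 0 ≤ d) (ha : 0 ≤ a) : 0 ≤ incrementBound d a :=
  div_nonneg hd (mul_nonneg ha (ha.trans (le_max_left _ _)))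

lemma logModulus_nonneg {d : ℝ} (hd : 0 ≤ d) : 0 ≤ logModulus d := by
  unfold logModulus
  positivity

lemma norm_logGrad (z : Plane) : ‖logGrad z‖ = 1 / ‖z‖ := by
  rcases eq_or_ne z 0 with rfl | hz
  · simp [logGrad]
  · have := norm_pos_iff.2 hz
    rw [logGrad, norm_smul, norm_pow, norm_div, norm_norm, norm_one]
    field_simp

/-- `logGrad` is inversion in the unit circle, so the increment equals |a-b|/(|a||b|). The larger of
|a|, |b| is at least |a-b|/2, which leaves only one integrable pole. -/
lemma norm_logGrad_sub_le {a b : Plane} (ha : a ≠ 0) (hb : b ≠ 0) :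
    ‖logGrad a - logGrad b‖ ≤
      incrementBound ‖a - b‖ ‖a‖ + incrementBound ‖a - b‖ ‖b‖ := by
  have key : ∀ {a b : Plane}, a ≠ 0 → b ≠ 0 → ‖a‖ ≤ ‖b‖ →
      ‖a - b‖ / (‖a‖ * ‖b‖) ≤ incrementBound ‖a - b‖ ‖a‖ := by
    intro a b ha hb h
    have ha' := norm_pos_iff.2 ha
    have := norm_sub_le a b
    unfold incrementBound
    gcongr
    exact max_le h (by linarith)
  have h := dist_div_norm_sq_smul ha hb 1
  rw [dist_eq_norm, dist_eq_norm] at h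
  rw [logGrad, logGrad, h, one_pow, div_mul_eq_mul_div, one_mul]
  rcases le_total ‖a‖ ‖b‖ with hab | hab
  · exact (key ha hb hab).trans
      (le_add_of_nonneg_right (incrementBound_nonneg (norm_nonneg _) (norm_nonneg _)))
  · have := key hb ha hab
    rw [norm_sub_rev b a, mul_comm ‖b‖] at this
    exact this.trans
      (le_add_of_nonneg_left (incrementBound_nonneg (norm_nonneg _) (norm_nonneg _)))

/-- For |b-a| ≤ 2|a| apply log s ≤ s - 1 to s = |b|²/|a|², whose expansion contains the gradient
term. For larger increments the logarithmic difference and the gradient term are each at most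
|b-a|/|a|. -/
lemma log_norm_sub_sub_inner_le {a b : Plane} (ha : a ≠ 0) (hb : b ≠ 0) :
    Real.log ‖b‖ - Real.log ‖a‖ - inner ℝ (logGrad a) (b - a) ≤
      2 * (‖b - a‖ * incrementBound ‖b - a‖ ‖a‖) := by
  have ha' := norm_pos_iff.2 ha
  have hb' := norm_pos_iff.2 hb
  rcases le_total (‖b - a‖ / 2) ‖a‖ with h | h
  · have hl : Real.log ‖b‖ - Real.log ‖a‖ ≤ 2⁻¹ * (‖b‖ ^ 2 / ‖a‖ ^ 2 - 1) := by
      have := Real.log_le_sub_one_of_pos (x := (‖b‖ / ‖a‖) ^ 2) (by positivity)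
      rw [Real.log_pow, Real.log_div hb'.ne' ha'.ne', div_pow] at this
      push_cast at this
      linarith
    have hn : ‖b‖ ^ 2 = ‖a‖ ^ 2 + 2 * inner ℝ a (b - a) + ‖b - a‖ ^ 2 := by
      rw [← norm_add_sq_real, add_sub_cancel]
    have hi : inner ℝ (logGrad a) (b - a) = inner ℝ a (b - a) / ‖a‖ ^ 2 := by
      rw [logGrad, inner_smul_left]
      simp only [conj_trivial]
      field_simp
    have hB : ‖b - a‖ * incrementBound ‖b - a‖ ‖a‖ = ‖b - a‖ ^ 2 / ‖a‖ ^ 2 := by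
      rw [incrementBound, max_eq_left h]
      field_simp
    rw [hi, hB]
    rw [hn] at hl
    have e : 2⁻¹ * ((‖a‖ ^ 2 + 2 * inner ℝ a (b - a) + ‖b - a‖ ^ 2) / ‖a‖ ^ 2 - 1) =
        inner ℝ a (b - a) / ‖a‖ ^ 2 + 2⁻¹ * (‖b - a‖ ^ 2 / ‖a‖ ^ 2) := by
      field_simp
      ring
    have : 0 ≤ ‖b - a‖ ^ 2 / ‖a‖ ^ 2 := by positivity
    linarith
  · have hd : 0 < ‖b - a‖ := by linarith
    have hl : Real.log ‖b‖ - Real.log ‖a‖ ≤ ‖b - a‖ / ‖a‖ := by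
      rw [← Real.log_div hb'.ne' ha'.ne']
      refine (Real.log_le_sub_one_of_pos (by positivity)).trans ?_
      rw [sub_le_iff_le_add, ← div_self ha'.ne', ← add_div]
      gcongr
      have := norm_add_le (b - a) a
      rwa [sub_add_cancel] at this
    have hi : -inner ℝ (logGrad a) (b - a) ≤ ‖b - a‖ / ‖a‖ := by
      refine (neg_le_abs _).trans ((abs_real_inner_le_norm _ _).trans (le_of_eq ?_))
      rw [norm_logGrad]
      ring
    have hB : ‖b - a‖ * incrementBound ‖b - a‖ ‖a‖ = 2 * (‖b - a‖ / ‖a‖) := by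
      rw [incrementBound, max_eq_right h]
      field_simp
    have : 0 ≤ ‖b - a‖ / ‖a‖ := by positivity
    rw [hB]
    linarith

/-- The lower bound is the upper one with a and b exchanged, after moving the gradient from b back
to a. The constant 3 is 2 from the expansion plus 1 from the gradient increment. -/
lemma abs_log_norm_sub_sub_inner_le {a b : Plane} (ha : a ≠ 0) (hb : b ≠ 0) :
    |Real.log ‖b‖ - Real.log ‖a‖ - inner ℝ (logGrad a) (b - a)| ≤
      3 * (‖b - a‖ * (incrementBound ‖b - a‖ ‖a‖ + incrementBound ‖b - a‖ ‖b‖)) := by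
  have h1 := log_norm_sub_sub_inner_le ha hb
  have h2 := log_norm_sub_sub_inner_le hb ha
  have h3 := abs_real_inner_le_norm (logGrad b - logGrad a) (b - a)
  have h4 := norm_logGrad_sub_le hb ha
  have hp := mul_nonneg (norm_nonneg (b - a))
    (incrementBound_nonneg (norm_nonneg (b - a)) (norm_nonneg a))
  have hq := mul_nonneg (norm_nonneg (b - a))
    (incrementBound_nonneg (norm_nonneg (b - a)) (norm_nonneg b))
  rw [norm_sub_rev a b, ← neg_sub b a, inner_neg_right] at h2
  rw [inner_sub_left] at h3
  have h5 := neg_abs_le (inner ℝ (logGrad b) (b - a) - inner ℝ (logGrad a) (b - a))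
  have h6 := mul_le_mul_of_nonneg_right h4 (norm_nonneg (b - a))
  rw [abs_le]
  constructor <;> nlinarith

/-- The integrand is d/max(y, d/2): it contributes d below d/2 and d log(2/d) above. This is where
the logarithm in the modulus of continuity originates. -/
lemma integral_mul_incrementBound_le {d : ℝ} (hd : 0 < d) (hd2 : d ≤ 2) :
    IntervalIntegrable (fun y => y * incrementBound d y) volume 0 1 ∧
      ∫ y in (0 : ℝ)..1, y * incrementBound d y ≤ 2 * logModulus d := by
  have hc : Continuous fun y : ℝ => d / max y (d / 2) := by
    refine continuous_const.div (by fun_prop) fun y => ?_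
    have : d / 2 ≤ max y (d / 2) := le_max_right _ _
    linarith
  have he : ∀ y ∈ Set.Ioc (0 : ℝ) 1, d / max y (d / 2) = y * incrementBound d y := by
    intro y hy
    have : 0 < max y (d / 2) := lt_max_of_lt_left hy.1
    have := hy.1
    rw [incrementBound]
    field_simp
  have hint := hc.intervalIntegrable (μ := volume) 0 1
  refine ⟨hint.congr (by rwa [Set.uIoc_of_le zero_le_one]), ?_⟩
  have e1 : ∫ y in (0 : ℝ)..1, y * incrementBound d y = ∫ y in (0 : ℝ)..1, d / max y (d / 2) := by
    rw [intervalIntegral.integral_of_le zero_le_one, intervalIntegral.integral_of_le zero_le_one]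
    exact (setIntegral_congr_fun measurableSet_Ioc he).symm
  rw [e1, ← intervalIntegral.integral_add_adjacent_intervals (b := d / 2)
    (hc.intervalIntegrable _ _) (hc.intervalIntegrable _ _)]
  have e2 : ∫ y in (0 : ℝ)..d / 2, d / max y (d / 2) = ∫ y in (0 : ℝ)..d / 2, 2 := by
    refine intervalIntegral.integral_congr fun y hy => ?_
    rw [Set.uIcc_of_le (by linarith)] at hy
    simp only [max_eq_right hy.2]
    field_simp
  have e3 : ∫ y in d / 2..1, d / max y (d / 2) = ∫ y in d / 2..1, d * y⁻¹ := by
    refine intervalIntegral.integral_congr fun y hy => ?_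
    rw [Set.uIcc_of_le (by linarith)] at hy
    simp only [max_eq_left hy.1]
    rfl
  rw [e2, e3, intervalIntegral.integral_const, intervalIntegral.integral_const_mul,
    integral_inv_of_pos (by linarith) one_pos, Real.log_div one_ne_zero (by positivity),
    Real.log_one, Real.log_div hd.ne' two_ne_zero, logModulus]
  have h1 := neg_le_abs (Real.log d)
  have h2 := Real.log_two_lt_d9
  simp only [smul_eq_mul]
  nlinarith [abs_nonneg (Real.log d)]

lemma lintegral_closedBall_incrementBound_le {d : ℝ} (hd : 0 < d) (hd2 : d ≤ 2) :
    ∫⁻ z in Metric.closedBall (0 : Plane) 1, ENNReal.ofReal (incrementBound d ‖z‖) ≤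
      ENNReal.ofReal (4 * Real.pi * logModulus d) := by
  obtain ⟨hi, hle⟩ := integral_mul_incrementBound_le hd hd2
  set F : ℝ → ℝ := (Set.Iic 1).indicator (incrementBound d) with hF
  have hFe : ∀ y ∈ Set.Ioi (0 : ℝ), y ^ (Module.finrank ℝ Plane - 1) • F y =
      (Set.Ioc 0 1).indicator (fun y => y * incrementBound d y) y := by
    intro y hy
    have : Module.finrank ℝ Plane = 2 := by simp
    rw [this, hF]
    by_cases h : y ≤ 1
    · rw [Set.indicator_of_mem (show y ∈ Set.Iic (1 : ℝ) from h),
        Set.indicator_of_mem (show y ∈ Set.Ioc (0 : ℝ) 1 from ⟨hy, h⟩)]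
      simp
    · rw [Set.indicator_of_notMem (show y ∉ Set.Iic (1 : ℝ) from h),
        Set.indicator_of_notMem (show y ∉ Set.Ioc (0 : ℝ) 1 from fun h' => h h'.2)]
      simp
  have hIoc : Set.Ioi (0 : ℝ) ∩ Set.Ioc 0 1 = Set.Ioc 0 1 :=
    Set.inter_eq_right.2 fun y hy => hy.1
  have hFi : Integrable (fun z : Plane => F ‖z‖) := by
    rw [integrable_fun_norm_addHaar]
    rw [integrableOn_congr_fun hFe measurableSet_Ioi]
    rw [intervalIntegrable_iff_integrableOn_Ioc_of_le zero_le_one] at hi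
    exact (hi.integrable_indicator measurableSet_Ioc).integrableOn
  have hFint : ∫ z : Plane, F ‖z‖ ≤ 4 * Real.pi * logModulus d := by
    rw [integral_fun_norm_addHaar, setIntegral_congr_fun measurableSet_Ioi hFe,
      setIntegral_indicator measurableSet_Ioc, hIoc, ← intervalIntegral.integral_of_le zero_le_one]
    have hv : (volume : Measure Plane).real (Metric.ball 0 1) = Real.pi := by
      simp [Measure.real, EuclideanSpace.volume_ball_fin_two, Real.pi_nonneg]
    rw [hv]
    simp only [finrank_euclideanSpace, Fintype.card_fin, smul_eq_mul, nsmul_eq_mul]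
    push_cast
    nlinarith [Real.pi_pos]
  rw [← lintegral_indicator Metric.isClosed_closedBall.measurableSet]
  have e : ∀ z : Plane, (Metric.closedBall (0 : Plane) 1).indicator
      (fun z => ENNReal.ofReal (incrementBound d ‖z‖)) z = ENNReal.ofReal (F ‖z‖) := by
    intro z
    by_cases h : ‖z‖ ≤ 1
    · rw [Set.indicator_of_mem (by simpa using h), hF,
        Set.indicator_of_mem (show ‖z‖ ∈ Set.Iic (1 : ℝ) from h)]
    · rw [Set.indicator_of_notMem (by simpa using h), hF,
        Set.indicator_of_notMem (show ‖z‖ ∉ Set.Iic (1 : ℝ) from h), ENNReal.ofReal_zero]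
  simp_rw [e]
  rw [← ofReal_integral_eq_lintegral_ofReal hFi (.of_forall fun z => Set.indicator_apply_nonneg
    fun _ => incrementBound_nonneg hd.le (norm_nonneg _))]
  exact ENNReal.ofReal_le_ofReal hFint

/-! ### Uniform estimates for potentials of measures of bounded density. -/

section BoundedDensity

variable {ρ : Measure Plane} {C : ℝ}

/-- Within distance 1 of x the density bound reduces to a Lebesgue integral. Farther away the
integrand is at most d and the total mass is 1. -/
lemma integral_incrementBound_le [IsProbabilityMeasure ρ] (hC : 0 ≤ C)
    (hρ : ρ ≤ ENNReal.ofReal C • volume) (x : Plane) {d : ℝ} (hd : 0 < d) (hd2 : d ≤ 2) :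
    Integrable (fun w => incrementBound d ‖x - w‖) ρ ∧
      ∫ w, incrementBound d ‖x - w‖ ∂ρ ≤ (4 * Real.pi * C + 1) * logModulus d := by
  have hm := logModulus_nonneg hd.le
  have hdm : d ≤ logModulus d := le_mul_of_one_le_right hd.le (by simp)
  have h : ∫⁻ w, ENNReal.ofReal (incrementBound d ‖x - w‖) ∂ρ ≤
      ENNReal.ofReal ((4 * Real.pi * C + 1) * logModulus d) := by
    set B := (Metric.closedBall (0 : Plane) 1).indicator
      fun z => ENNReal.ofReal (incrementBound d ‖z‖) with hB
    calc ∫⁻ w, ENNReal.ofReal (incrementBound d ‖x - w‖) ∂ρ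
        ≤ ∫⁻ w, (B (x - w) + ENNReal.ofReal d) ∂ρ := by
          refine lintegral_mono fun w => ?_
          by_cases h : ‖x - w‖ ≤ 1
          · rw [hB, Set.indicator_of_mem (by simpa using h)]
            exact le_self_add
          · refine le_add_of_le_right (ENNReal.ofReal_le_ofReal ?_)
            push Not at h
            refine div_le_self hd.le ?_
            have := le_max_left ‖x - w‖ (d / 2)
            nlinarith
      _ = (∫⁻ w, B (x - w) ∂ρ) + ENNReal.ofReal d := by
          rw [lintegral_add_right _ measurable_const]
          simp
      _ ≤ ENNReal.ofReal C * (∫⁻ w, B (x - w)) + ENNReal.ofReal d := by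
          gcongr
          refine (lintegral_mono' hρ le_rfl).trans (le_of_eq ?_)
          rw [lintegral_smul_measure, smul_eq_mul]
      _ ≤ ENNReal.ofReal C * ENNReal.ofReal (4 * Real.pi * logModulus d) +
            ENNReal.ofReal (logModulus d) := by
          rw [lintegral_sub_left_eq_self B x, hB,
            lintegral_indicator Metric.isClosed_closedBall.measurableSet]
          gcongr
          exact lintegral_closedBall_incrementBound_le hd hd2
      _ = _ := by
          rw [← ENNReal.ofReal_mul hC, ← ENNReal.ofReal_add (by positivity) hm]
          congr 1
          ring
  have hnn : ∀ w, 0 ≤ incrementBound d ‖x - w‖ := fun w =>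
    incrementBound_nonneg hd.le (norm_nonneg _)
  have hmeas : Measurable fun w => incrementBound d ‖x - w‖ := by fun_prop
  refine ⟨⟨hmeas.aestronglyMeasurable, ?_⟩, ?_⟩
  · rw [hasFiniteIntegral_iff_ofReal (.of_forall hnn)]
    exact h.trans_lt ENNReal.ofReal_lt_top
  · rw [integral_eq_lintegral_of_nonneg_ae (.of_forall hnn) hmeas.aestronglyMeasurable]
    exact ENNReal.toReal_le_of_le_ofReal (by positivity) h

lemma ae_sub_ne_zero_of_le_smul_volume (hρ : ρ ≤ ENNReal.ofReal C • volume) (x : Plane) :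
    ∀ᵐ w ∂ρ, x - w ≠ 0 := by
  have h : ρ {x} = 0 := le_antisymm ((hρ {x}).trans (by simp)) zero_le
  filter_upwards [measure_eq_zero_iff_ae_notMem.1 h] with w hw h0
  exact hw (sub_eq_zero.1 h0).symm

/-- The case d = 2 of the increment estimate thereby also gives integrability of the gradient and of
the logarithm. -/
lemma one_div_norm_le (z : Plane) : 1 / ‖z‖ ≤ incrementBound 2 ‖z‖ + 1 := by
  rcases (norm_nonneg z).eq_or_lt with h | h
  · rw [← h]
    simp [incrementBound]
  rcases le_total ‖z‖ 1 with h1 | h1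
  · rw [incrementBound, div_self two_ne_zero, max_eq_right h1, mul_one]
    have : 1 / ‖z‖ ≤ 2 / ‖z‖ := by gcongr; norm_num
    linarith
  · have := incrementBound_nonneg zero_le_two h.le
    have : 1 / ‖z‖ ≤ 1 := (div_le_one h).2 h1
    linarith

lemma integrable_logGrad [IsProbabilityMeasure ρ] (hC : 0 ≤ C)
    (hρ : ρ ≤ ENNReal.ofReal C • volume) (x : Plane) :
    Integrable (fun w => logGrad (x - w)) ρ := by
  have hm : Measurable fun w => logGrad (x - w) := by fun_prop
  refine Integrable.mono' (((integral_incrementBound_le hC hρ x two_pos le_rfl).1).add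
    (integrable_const 1)) hm.aestronglyMeasurable (.of_forall fun w => ?_)
  rw [norm_logGrad]
  exact one_div_norm_le _

lemma integrable_log_norm_sub [IsProbabilityMeasure ρ] (hC : 0 ≤ C)
    (hρ : ρ ≤ ENNReal.ofReal C • volume) (hρ2 : IsP2 ρ) (x : Plane) :
    Integrable (fun w => Real.log ‖x - w‖) ρ := by
  have hm : Measurable fun w => Real.log ‖x - w‖ := by fun_prop
  refine Integrable.mono' ((((integral_incrementBound_le hC hρ x two_pos le_rfl).1).add
    (integrable_const (1 + ‖x‖))).add hρ2.integrable_norm) hm.aestronglyMeasurable ?_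
  filter_upwards [ae_sub_ne_zero_of_le_smul_volume hρ x] with w hw
  have h0 := norm_pos_iff.2 hw
  have h1 := Real.log_le_self h0.le
  have h2 := Real.log_le_self (inv_pos.2 h0).le
  have h3 := one_div_norm_le (x - w)
  rw [one_div] at h3
  rw [Real.log_inv] at h2
  have h4 := norm_sub_le x w
  have h5 := incrementBound_nonneg zero_le_two h0.le
  simp only [Pi.add_apply, Real.norm_eq_abs]
  rw [abs_le]
  constructor <;> linarith [inv_pos.2 h0, norm_nonneg x, norm_nonneg w]

/-- The logarithmic potential as a real integral. -/
def potential (ρ : Measure Plane) (x : Plane) : ℝ := ∫ w, -Real.log ‖x - w‖ ∂ρ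

/-- The gradient of the logarithmic potential. -/
def potentialGrad (ρ : Measure Plane) (x : Plane) : Plane := -∫ w, logGrad (x - w) ∂ρ

lemma logPotential_eq_potential [IsProbabilityMeasure ρ] (hC : 0 ≤ C)
    (hρ : ρ ≤ ENNReal.ofReal C • volume) (hρ2 : IsP2 ρ) (x : Plane) :
    logPotential ρ x = (potential ρ x : EReal) := by
  refine (logPotential_eq ?_).2
  have h := (integrable_log_norm_sub hC hρ hρ2 x).2
  refine ne_of_lt (lt_of_le_of_lt (le_of_eq (lintegral_congr_ae ?_)) h)
  filter_upwards [ae_sub_ne_zero_of_le_smul_volume hρ x] with w hw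
  rw [kerAbs_of_ne_zero hw, ← ofReal_norm, Real.norm_eq_abs]

lemma norm_potentialGrad_sub_le [IsProbabilityMeasure ρ] (hC : 0 ≤ C)
    (hρ : ρ ≤ ENNReal.ofReal C • volume) {x y : Plane} (hxy : ‖x - y‖ ≤ 2) :
    ‖potentialGrad ρ x - potentialGrad ρ y‖ ≤
      2 * (4 * Real.pi * C + 1) * logModulus ‖x - y‖ := by
  rcases eq_or_ne x y with rfl | hne
  · simp [logModulus]
  have hd : 0 < ‖x - y‖ := norm_pos_iff.2 (sub_ne_zero.2 hne)
  obtain ⟨hi1, hle1⟩ := integral_incrementBound_le hC hρ x hd hxy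
  obtain ⟨hi2, hle2⟩ := integral_incrementBound_le hC hρ y hd hxy
  rw [potentialGrad, potentialGrad, neg_sub_neg, ← neg_sub, norm_neg,
    ← integral_sub (integrable_logGrad hC hρ x) (integrable_logGrad hC hρ y)]
  calc _ ≤ ∫ w, (incrementBound ‖x - y‖ ‖x - w‖ + incrementBound ‖x - y‖ ‖y - w‖) ∂ρ := by
        refine norm_integral_le_of_norm_le (hi1.add hi2) ?_
        filter_upwards [ae_sub_ne_zero_of_le_smul_volume hρ x,
          ae_sub_ne_zero_of_le_smul_volume hρ y] with w hx hy
        have := norm_logGrad_sub_le hx hy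
        rwa [sub_sub_sub_cancel_right] at this
    _ ≤ _ := by
        rw [integral_add hi1 hi2]
        linarith

lemma abs_potential_sub_sub_inner_le [IsProbabilityMeasure ρ] (hC : 0 ≤ C)
    (hρ : ρ ≤ ENNReal.ofReal C • volume) (hρ2 : IsP2 ρ) {x y : Plane} (hxy : ‖y - x‖ ≤ 2) :
    |potential ρ y - potential ρ x - inner ℝ (potentialGrad ρ x) (y - x)| ≤
      6 * (4 * Real.pi * C + 1) * (‖y - x‖ * logModulus ‖y - x‖) := by
  rcases eq_or_ne y x with rfl | hne
  · simp [logModulus]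
  have hd : 0 < ‖y - x‖ := norm_pos_iff.2 (sub_ne_zero.2 hne)
  obtain ⟨hi1, hle1⟩ := integral_incrementBound_le hC hρ x hd hxy
  obtain ⟨hi2, hle2⟩ := integral_incrementBound_le hC hρ y hd hxy
  have hx := integrable_log_norm_sub hC hρ hρ2 x
  have hy := integrable_log_norm_sub hC hρ hρ2 y
  have hg := integrable_logGrad hC hρ x
  have e : potential ρ y - potential ρ x - inner ℝ (potentialGrad ρ x) (y - x) =
      -∫ w, (Real.log ‖y - w‖ - Real.log ‖x - w‖ - inner ℝ (logGrad (x - w)) (y - x)) ∂ρ := by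
    rw [integral_sub (f := fun w => Real.log ‖y - w‖ - Real.log ‖x - w‖) (hy.sub hx)
      (hg.inner_const (y - x)), integral_sub hy hx, potential, potential,
      potentialGrad, inner_neg_left, integral_neg, integral_neg, real_inner_comm,
      ← integral_inner hg]
    simp only [real_inner_comm (y - x)]
    ring
  rw [e, abs_neg, ← Real.norm_eq_abs]
  calc _ ≤ ∫ w, 3 * (‖y - x‖ * (incrementBound ‖y - x‖ ‖x - w‖ +
        incrementBound ‖y - x‖ ‖y - w‖)) ∂ρ := by
        refine norm_integral_le_of_norm_le (((hi1.add hi2).const_mul _).const_mul _) ?_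
        filter_upwards [ae_sub_ne_zero_of_le_smul_volume hρ x,
          ae_sub_ne_zero_of_le_smul_volume hρ y] with w hx hy
        have := abs_log_norm_sub_sub_inner_le hx hy
        rwa [sub_sub_sub_cancel_right] at this
    _ ≤ _ := by
        rw [integral_const_mul, integral_const_mul, integral_add hi1 hi2]
        nlinarith

lemma norm_potentialGrad_le [IsProbabilityMeasure ρ] (hC : 0 ≤ C)
    (hρ : ρ ≤ ENNReal.ofReal C • volume) (x : Plane) :
    ‖potentialGrad ρ x‖ ≤ (4 * Real.pi * C + 1) * logModulus 2 + 1 := by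
  obtain ⟨hi, hle⟩ := integral_incrementBound_le hC hρ x two_pos le_rfl
  rw [potentialGrad, norm_neg]
  calc _ ≤ ∫ w, (incrementBound 2 ‖x - w‖ + 1) ∂ρ := by
        refine norm_integral_le_of_norm_le (hi.add (integrable_const 1)) (.of_forall fun w => ?_)
        rw [norm_logGrad]
        exact one_div_norm_le _
    _ ≤ _ := by
        rw [integral_add hi (integrable_const 1)]
        simpa using hle

lemma logModulus_eq {d : ℝ} (hd : 0 ≤ d) : logModulus d = d + |d * Real.log d| := by
  rw [logModulus, abs_mul, abs_of_nonneg hd]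
  ring

lemma tendsto_logModulus_norm {E : Type*} [SeminormedAddCommGroup E] :
    Filter.Tendsto (fun z : E => logModulus ‖z‖) (nhds 0) (nhds 0) := by
  have h : Continuous fun z : E => ‖z‖ + |‖z‖ * Real.log ‖z‖| := by
    have := Real.continuous_mul_log.comp (continuous_norm (E := E))
    exact continuous_norm.add this.abs
  have h2 := h.tendsto 0
  simp only [norm_zero, zero_mul, abs_zero, add_zero] at h2
  refine h2.congr fun z => (logModulus_eq (norm_nonneg z)).symm

lemma hasGradientAt_potential [IsProbabilityMeasure ρ] (hC : 0 ≤ C)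
    (hρ : ρ ≤ ENNReal.ofReal C • volume) (hρ2 : IsP2 ρ) (x : Plane) :
    HasGradientAt (potential ρ) (potentialGrad ρ x) x := by
  rw [hasGradientAt_iff_isLittleO]
  have ht : Filter.Tendsto (fun y => 6 * (4 * Real.pi * C + 1) * logModulus ‖y - x‖) (nhds x)
      (nhds 0) := by
    have h1 : Filter.Tendsto (fun y => y - x) (nhds x) (nhds 0) :=
      tendsto_sub_nhds_zero_iff.2 Filter.tendsto_id
    simpa using (tendsto_logModulus_norm.comp h1).const_mul (6 * (4 * Real.pi * C + 1))
  have hb : ∀ᶠ y in nhds x, ‖y - x‖ ≤ 2 := by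
    filter_upwards [Metric.closedBall_mem_nhds x two_pos] with y hy
    rwa [Metric.mem_closedBall, dist_eq_norm] at hy
  rw [Asymptotics.isLittleO_iff]
  intro c hc
  filter_upwards [hb, ht.eventually (gt_mem_nhds hc)] with y hy hyc
  rw [Real.norm_eq_abs]
  refine (abs_potential_sub_sub_inner_le hC hρ hρ2 hy).trans ?_
  nlinarith [norm_nonneg (y - x)]

lemma isLogLipschitz_potentialGrad [IsProbabilityMeasure ρ] (hC : 0 ≤ C)
    (hρ : ρ ≤ ENNReal.ofReal C • volume) : IsLogLipschitz (potentialGrad ρ) := by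
  set K := 4 * Real.pi * C + 1
  have hK : 0 ≤ K := by positivity
  have hm2 := logModulus_nonneg zero_le_two
  refine ⟨2 * K + (K * logModulus 2 + 1), fun x y => ?_⟩
  change _ ≤ _ * logModulus ‖x - y‖
  have hm := logModulus_nonneg (norm_nonneg (x - y))
  rcases le_total ‖x - y‖ 2 with h | h
  · refine (norm_potentialGrad_sub_le hC hρ h).trans ?_
    gcongr
    have : 0 ≤ K * logModulus 2 + 1 := by positivity
    linarith
  -- At distances above 2 boundedness of the gradient is enough, since the modulus is at least 2
  -- there.
  · have h1 := norm_sub_le (potentialGrad ρ x) (potentialGrad ρ y)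
    have h2 := norm_potentialGrad_le hC hρ x
    have h3 := norm_potentialGrad_le hC hρ y
    have h4 : 2 ≤ logModulus ‖x - y‖ := h.trans
      (le_mul_of_one_le_right (norm_nonneg _) (by simp))
    have h5 : 0 ≤ K * logModulus 2 := by positivity
    nlinarith

end BoundedDensity

/-! ### Almost optimal plans concentrate on the graph of `x ↦ x + 2 ∇U x` -/

/-- The normalization of a vector, zero at the origin. -/
def unitVector (v : Plane) : Plane := ‖v‖⁻¹ • v

@[fun_prop]
lemma measurable_unitVector : Measurable unitVector := by
  unfold unitVector
  fun_prop

lemma norm_unitVector_le (v : Plane) : ‖unitVector v‖ ≤ 1 := by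
  rw [unitVector, norm_smul, norm_inv, norm_norm]
  exact inv_mul_le_one

lemma inner_unitVector (v : Plane) : inner ℝ v (unitVector v) = ‖v‖ := by
  rcases eq_or_ne v 0 with rfl | hv
  · simp
  · have := norm_pos_iff.2 hv
    rw [unitVector, inner_smul_right, real_inner_self_eq_norm_sq]
    field_simp

/-- The map `x ↦ x + 2 ∇U x`. -/
def transportMap (ρ : Measure Plane) (x : Plane) : Plane := x + (2 : ℝ) • potentialGrad ρ x

/-- The deviation of a pair of points from the graph of `transportMap ρ`. -/
def deviation (ρ : Measure Plane) (p : Plane × Plane) : Plane := transportMap ρ p.1 - p.2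

section BoundedDensity

variable {ρ : Measure Plane} {C : ℝ}

lemma continuous_potentialGrad [IsProbabilityMeasure ρ] (hC : 0 ≤ C)
    (hρ : ρ ≤ ENNReal.ofReal C • volume) : Continuous (potentialGrad ρ) := by
  rw [continuous_iff_continuousAt]
  intro x
  rw [ContinuousAt, tendsto_iff_norm_sub_tendsto_zero]
  have ht : Filter.Tendsto (fun y => 2 * (4 * Real.pi * C + 1) * logModulus ‖y - x‖) (nhds x)
      (nhds 0) := by
    simpa using (tendsto_logModulus_norm.comp
      (tendsto_sub_nhds_zero_iff.2 Filter.tendsto_id)).const_mul (2 * (4 * Real.pi * C + 1))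
  refine squeeze_zero' (.of_forall fun y => norm_nonneg _) ?_ ht
  filter_upwards [Metric.closedBall_mem_nhds x two_pos] with y hy
  rw [Metric.mem_closedBall, dist_eq_norm] at hy
  exact norm_potentialGrad_sub_le hC hρ hy

/-- The remainder bound does not depend on x, so one τ serves all points. The range 2τ covers a
shift of length τ followed by a circle of radius τ. -/
lemma exists_radius_potential_approx [IsProbabilityMeasure ρ] (hC : 0 ≤ C)
    (hρ : ρ ≤ ENNReal.ofReal C • volume) (hρ2 : IsP2 ρ) {η : ℝ} (hη : 0 < η) :
    ∃ τ > 0, τ ≤ η ∧ ∀ x h, ‖h‖ ≤ 2 * τ →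
      |potential ρ (x + h) - potential ρ x - inner ℝ (potentialGrad ρ x) h| ≤ η * ‖h‖ := by
  have ht : Filter.Tendsto (fun z : Plane => 6 * (4 * Real.pi * C + 1) * logModulus ‖z‖) (nhds 0)
      (nhds 0) := by
    simpa using (tendsto_logModulus_norm (E := Plane)).const_mul (6 * (4 * Real.pi * C + 1))
  obtain ⟨t, ht0, ht⟩ := Metric.eventually_nhds_iff_ball.1 (ht.eventually (gt_mem_nhds hη))
  refine ⟨min η (min 1 (t / 4)), by positivity, min_le_left _ _, fun x h hh => ?_⟩
  have h1 : min η (min 1 (t / 4)) ≤ 1 := (min_le_right _ _).trans (min_le_left _ _)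
  have h2 : min η (min 1 (t / 4)) ≤ t / 4 := (min_le_right _ _).trans (min_le_right _ _)
  have h3 := ht h (by rw [mem_ball_zero_iff]; linarith)
  have h4 := abs_potential_sub_sub_inner_le hC hρ hρ2 (x := x) (y := x + h)
    (by rw [add_sub_cancel_left]; linarith)
  rw [add_sub_cancel_left] at h4
  refine h4.trans ?_
  nlinarith [norm_nonneg h]

/-- The circle average kills the part of the linear term along the direction, leaving only the shift
-τu. -/
lemma abs_integral_potential_sub_le {x u : Plane} {τ η : ℝ} (hτ : 0 < τ) (hη : 0 ≤ η)
    (hu : ‖u‖ ≤ 1) (happ : ∀ x h, ‖h‖ ≤ 2 * τ →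
      |potential ρ (x + h) - potential ρ x - inner ℝ (potentialGrad ρ x) h| ≤ η * ‖h‖)
    (hi : Integrable (fun θ => potential ρ (x - τ • u + τ • direction θ)) angleMeasure) :
    |∫ θ, potential ρ (x - τ • u + τ • direction θ) ∂angleMeasure - potential ρ x +
      τ * inner ℝ (potentialGrad ρ x) u| ≤ 2 * τ * η := by
  have hin : Integrable (fun θ => inner ℝ (potentialGrad ρ x) (τ • direction θ - τ • u))
      angleMeasure :=
    ((integrable_direction.smul τ).sub (integrable_const (τ • u))).const_inner _
  have e2 : ∫ θ, inner ℝ (potentialGrad ρ x) (τ • direction θ - τ • u) ∂angleMeasure =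
      -(τ * inner ℝ (potentialGrad ρ x) u) := by
    rw [integral_inner (f := fun θ => τ • direction θ - τ • u)
      ((integrable_direction.smul τ).sub (integrable_const (τ • u))),
      integral_sub (f := fun θ => τ • direction θ) (integrable_direction.smul τ)
      (integrable_const _), integral_smul, integral_direction]
    simp [inner_neg_right, inner_smul_right]
  have e : ∫ θ, potential ρ (x - τ • u + τ • direction θ) ∂angleMeasure - potential ρ x +
      τ * inner ℝ (potentialGrad ρ x) u = ∫ θ, (potential ρ (x - τ • u + τ • direction θ) -
        potential ρ x - inner ℝ (potentialGrad ρ x) (τ • direction θ - τ • u)) ∂angleMeasure := by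
    rw [integral_sub (f := fun θ => potential ρ (x - τ • u + τ • direction θ) - potential ρ x)
      (hi.sub (integrable_const _)) hin, integral_sub hi (integrable_const _), e2]
    simp
  rw [e, ← Real.norm_eq_abs]
  have hb : ∀ θ, ‖potential ρ (x - τ • u + τ • direction θ) -
      potential ρ x - inner ℝ (potentialGrad ρ x) (τ • direction θ - τ • u)‖ ≤ 2 * τ * η := by
    intro θ
    have hh : ‖τ • direction θ - τ • u‖ ≤ 2 * τ := by
      refine (norm_sub_le _ _).trans ?_
      rw [norm_smul, norm_smul, norm_direction, Real.norm_eq_abs, abs_of_pos hτ]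
      nlinarith
    have h1 := happ x _ hh
    rw [show x + (τ • direction θ - τ • u) = x - τ • u + τ • direction θ by abel] at h1
    rw [Real.norm_eq_abs]
    nlinarith
  have := norm_integral_le_of_norm_le_const (μ := angleMeasure) (.of_forall hb)
  simpa using this

end BoundedDensity

/-- The potential of a circle of radius t never exceeds -log t. The self-energy of the competitor is
thus bounded independently of the plan. -/
lemma logPair_smear_le_neg_log {γ : Measure (Plane × Plane)} [IsProbabilityMeasure γ]
    {a : Plane × Plane → Plane} (ha : Measurable a) {t : ℝ} (ht : 0 < t) {ν : Measure Plane}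
    [IsProbabilityMeasure ν] (h : FinEnergy (smear γ a fun _ => t) ν) :
    logPair (smear γ a fun _ => t) ν ≤ -Real.log t := by
  obtain ⟨h1, h2⟩ := logPair_smear ha measurable_const h
  rw [h2]
  have h3 : ∫ _ : Plane × Plane, -Real.log t ∂γ = -Real.log t := by simp
  rw [← h3]
  refine integral_mono_ae h1.integral_prod_left (integrable_const _) ?_
  filter_upwards [integral_integral_smear_eq ha measurable_const h] with p hp
  rw [hp.2]
  have h4 : ∫ _ : Plane, -Real.log t ∂ν = -Real.log t := by simp
  rw [← h4]
  refine integral_mono hp.1 (integrable_const _) fun w => ?_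
  have := Real.log_le_log ht ((le_abs_self t).trans (le_max_right ‖a p - w‖ |t|))
  simp only
  linarith

/-! ### Perturbing an almost optimal plan along its deviation. -/

section Minimizer

variable {ρ₀ ρ : Measure Plane} {C : ℝ} {γ : Measure (Plane × Plane)}

lemma measurable_deviation [IsProbabilityMeasure ρ] (hC : 0 ≤ C)
    (hle : ρ ≤ ENNReal.ofReal C • volume) : Measurable (deviation ρ) := by
  have := (continuous_potentialGrad hC hle).measurable
  unfold deviation transportMap
  fun_prop

lemma norm_sub_le_one_add_sq {E : Type*} [SeminormedAddCommGroup E] (x : E) :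
    ‖x‖ ≤ 1 + ‖x‖ ^ 2 := by
  nlinarith [sq_nonneg (‖x‖ - 1), norm_nonneg x]

lemma IsPlan.integrable_deviation (hρ : IsP2 ρ) (hρ₀ : IsP2 ρ₀) (hC : 0 ≤ C)
    (hle : ρ ≤ ENNReal.ofReal C • volume) (hγ : IsPlan ρ ρ₀ γ) :
    Integrable (fun p => ‖deviation ρ p‖) γ := by
  have := hρ.1
  have := hγ.isProbabilityMeasure
  refine Integrable.mono' (((integrable_const 1).add (hγ.integrable_sq hρ hρ₀)).add
    (integrable_const (2 * ((4 * Real.pi * C + 1) * logModulus 2 + 1))))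
    (measurable_deviation hC hle).norm.aestronglyMeasurable (.of_forall fun p => ?_)
  rw [norm_norm, deviation, transportMap, add_sub_right_comm]
  refine (norm_add_le _ _).trans ?_
  rw [norm_smul, Real.norm_ofNat]
  have h1 := norm_potentialGrad_le hC hle p.1
  have h2 := norm_sub_le_one_add_sq (p.1 - p.2)
  simp only [Pi.add_apply]
  linarith

lemma toReal_planCost_le_add {ε : ℝ} (hε : 0 ≤ ε) (hW : wassersteinSq ρ ρ₀ ≠ ∞)
    (h : planCost γ ≤ wassersteinSq ρ ρ₀ + ENNReal.ofReal ε) :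
    (planCost γ).toReal ≤ (wassersteinSq ρ ρ₀).toReal + ε := by
  have := ENNReal.toReal_mono (by finiteness) h
  rwa [ENNReal.toReal_add hW (by finiteness), ENNReal.toReal_ofReal hε] at this

/-- The competitor shifts x by -τu, with u the direction of the deviation. Energy and cost change to
first order by -τ∫⟨2∇U(x) + x - y, u⟩ dγ = -τ∫|deviation| dγ. The spreading of radius τ keeps the
self-energy finite even if the shift concentrates mass. -/
lemma IsMinimizer.integral_norm_deviation_le (hρ : IsMinimizer ρ₀ ρ) (hρ₀ : IsP2 ρ₀) (hC : 0 ≤ C)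
    (hle : ρ ≤ ENNReal.ofReal C • volume) (hγ : IsPlan ρ ρ₀ γ) {ε : ℝ} (hε : 0 ≤ ε)
    (hopt : planCost γ ≤ wassersteinSq ρ ρ₀ + ENNReal.ofReal ε) {τ η M : ℝ} (hτ : 0 < τ)
    (hη : 0 ≤ η) (hM : ∀ x, ‖potentialGrad ρ x‖ ≤ M) (happ : ∀ x h, ‖h‖ ≤ 2 * τ →
      |potential ρ (x + h) - potential ρ x - inner ℝ (potentialGrad ρ x) h| ≤ η * ‖h‖)
    {s : ℝ} (hs0 : 0 ≤ s) (hs1 : s ≤ 1) :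
    s * (τ * ∫ p, ‖deviation ρ p‖ ∂γ) ≤ ε + s * (4 * τ * η + τ ^ 2) +
      s ^ 2 * (-logPair ρ ρ + 2 * τ * M + 4 * τ * η - Real.log τ) := by
  have := hρ.1.1
  have := hγ.isProbabilityMeasure
  have hE := hρ.finEnergy_self hρ₀
  have hdm := measurable_deviation hC hle
  set u : Plane × Plane → Plane := fun p => unitVector (deviation ρ p) with hu
  have hum : Measurable u := measurable_unitVector.comp hdm
  have hu1 : ∀ p, ‖u p‖ ≤ 1 := fun p => norm_unitVector_le _
  set a : Plane × Plane → Plane := fun p => p.1 - τ • u p with ha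
  have ham : Measurable a := by fun_prop
  have ha2 : ∫⁻ p, ‖a p‖ₑ ^ 2 ∂γ < ∞ := by
    refine lt_of_le_of_lt (lintegral_mono (g := fun p => 2 * (‖p.1‖ₑ ^ 2 + ENNReal.ofReal τ ^ 2))
      fun p => ?_) ?_
    · have := enorm_add_sq_le p.1 (-(τ • u p))
      rw [← sub_eq_add_neg, enorm_neg] at this
      refine this.trans ?_
      beta_reduce
      gcongr
      rw [← ofReal_norm, norm_smul, Real.norm_eq_abs, abs_of_pos hτ]
      exact ENNReal.ofReal_le_ofReal (mul_le_of_le_one_right hτ.le (hu1 p))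
    · rw [lintegral_const_mul _ (by fun_prop), lintegral_add_left (by fun_prop)]
      exact ENNReal.mul_lt_top (by simp)
        (ENNReal.add_lt_top.2 ⟨hρ.1.lintegral_fst_sq_lt_top hγ, by simp⟩)
  have ha1 : ∫⁻ p, ‖a p‖ₑ ∂γ < ∞ := by
    refine lt_of_le_of_lt (lintegral_mono (g := fun p => ‖p.1‖ₑ + ENNReal.ofReal τ)
      fun p => ?_) ?_
    · refine enorm_sub_le.trans ?_
      beta_reduce
      gcongr
      rw [← ofReal_norm, norm_smul, Real.norm_eq_abs, abs_of_pos hτ]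
      exact ENNReal.ofReal_le_ofReal (mul_le_of_le_one_right hτ.le (hu1 p))
    · rw [lintegral_add_right _ measurable_const]
      exact ENNReal.add_lt_top.2 ⟨hρ.1.lintegral_fst_lt_top hγ, by simp⟩
  have hμ : IsP2 (smear γ a fun _ => τ) :=
    isP2_smear ham measurable_const ha2 (R := τ) fun _ => by rw [abs_of_pos hτ]
  have := hμ.1
  have hμρ : FinEnergy (smear γ a fun _ => τ) ρ :=
    finEnergy_smear_of_radius_ne_zero ham ha1 hτ.ne' hρ.1
  have hμμ := finEnergy_smear_of_radius_ne_zero ham ha1 hτ.ne' hμ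
  have hfv := hρ.first_variation hρ₀ hE hμ hμρ hμμ hγ (isPlan_smearPlan hγ ham measurable_const)
    hε hopt hs0 hs1
  have hμμle := logPair_smear_le_neg_log ham hτ hμμ
  have hsq := hγ.integrable_sq hρ.1 hρ₀
  -- the potential energy
  obtain ⟨hU, hUE⟩ := logPair_eq_integral_integral hE
  obtain ⟨hG, hGE⟩ := logPair_smear ham measurable_const hμρ
  have hVm := (continuous_potentialGrad hC hle).measurable
  have hVu : Integrable (fun p => inner ℝ (potentialGrad ρ p.1) (u p)) γ := by
    have hm : Measurable fun p : Plane × Plane => inner ℝ (potentialGrad ρ p.1) (u p) := by fun_prop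
    refine Integrable.of_bound (C := M) hm.aestronglyMeasurable (.of_forall fun p => ?_)
    refine (norm_inner_le_norm _ _).trans ?_
    exact (mul_le_of_le_one_right (norm_nonneg _) (hu1 p)).trans (hM _)
  have hUi := hγ.integrable_comp_fst hU
  have hpot : |logPair (smear γ a fun _ => τ) ρ - logPair ρ ρ +
      τ * ∫ p, inner ℝ (potentialGrad ρ p.1) (u p) ∂γ| ≤ 2 * τ * η := by
    have hd : Integrable (fun p =>
        (∫ θ, ∫ w, -Real.log ‖a p + τ • direction θ - w‖ ∂ρ ∂angleMeasure) -
        (∫ w, -Real.log ‖p.1 - w‖ ∂ρ)) γ := hG.integral_prod_left.sub hUi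
    rw [hUE, hGE, ← hγ.integral_comp_fst hU.1, ← integral_const_mul,
      ← integral_sub hG.integral_prod_left hUi, ← integral_add hd (hVu.const_mul τ),
      ← Real.norm_eq_abs]
    have := norm_integral_le_of_norm_le_const (μ := γ) (C := 2 * τ * η) (f := fun p =>
      (∫ θ, ∫ w, -Real.log ‖a p + τ • direction θ - w‖ ∂ρ ∂angleMeasure) -
        (∫ w, -Real.log ‖p.1 - w‖ ∂ρ) + τ * inner ℝ (potentialGrad ρ p.1) (u p)) ?_
    · simpa using this
    · filter_upwards [hG.prod_right_ae] with p hp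
      exact abs_integral_potential_sub_le hτ hη (hu1 p) happ hp
  -- the transport cost
  have hxu : Integrable (fun p => inner ℝ (p.1 - p.2) (u p)) γ := by
    have hm : Measurable fun p : Plane × Plane => inner ℝ (p.1 - p.2) (u p) := by fun_prop
    refine Integrable.mono' ((integrable_const 1).add hsq) hm.aestronglyMeasurable
      (.of_forall fun p => ?_)
    refine (norm_inner_le_norm _ _).trans ?_
    exact (mul_le_of_le_one_right (norm_nonneg _) (hu1 p)).trans (norm_sub_le_one_add_sq _)
  have hui : Integrable (fun p => ‖u p‖ ^ 2) γ := by
    refine Integrable.of_bound (C := 1) (by fun_prop) (.of_forall fun p => ?_)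
    rw [norm_pow, norm_norm]
    exact pow_le_one₀ (norm_nonneg _) (hu1 p)
  have hexp : ∀ p : Plane × Plane, ‖a p - p.2‖ ^ 2 =
      ‖p.1 - p.2‖ ^ 2 - (2 * τ * inner ℝ (p.1 - p.2) (u p) - τ ^ 2 * ‖u p‖ ^ 2) := by
    intro p
    rw [ha]
    simp only
    rw [sub_right_comm, norm_sub_sq_real, inner_smul_right, norm_smul, mul_pow, Real.norm_eq_abs,
      sq_abs]
    ring
  have hxui : Integrable (fun p => 2 * τ * inner ℝ (p.1 - p.2) (u p) - τ ^ 2 * ‖u p‖ ^ 2) γ :=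
    (hxu.const_mul _).sub (hui.const_mul _)
  have hai : Integrable (fun p => ‖a p - p.2‖ ^ 2) γ := by
    simp_rw [hexp]
    exact hsq.sub hxui
  -- The error τ² has two halves: one from the square of the shift, one from the spreading.
  have hcost : (planCost (smearPlan γ a fun _ => τ)).toReal - (planCost γ).toReal ≤
      -(τ * ∫ p, inner ℝ (p.1 - p.2) (u p) ∂γ) + τ ^ 2 := by
    rw [toReal_planCost_smearPlan ham measurable_const hai (R := τ) fun _ => by rw [abs_of_pos hτ],
      toReal_planCost]
    simp_rw [hexp]
    rw [integral_sub hsq hxui,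
      integral_sub (hxu.const_mul _) (hui.const_mul _), integral_const_mul, integral_const_mul]
    have h1 : ∫ p, ‖u p‖ ^ 2 ∂γ ≤ ∫ _ : Plane × Plane, (1 : ℝ) ∂γ :=
      integral_mono hui (integrable_const 1) fun p => pow_le_one₀ (norm_nonneg _) (hu1 p)
    simp only [integral_const, probReal_univ, smul_eq_mul, mul_one, one_mul] at h1 ⊢
    nlinarith [sq_nonneg τ]
  have hdev : ∫ p, ‖deviation ρ p‖ ∂γ = 2 * ∫ p, inner ℝ (potentialGrad ρ p.1) (u p) ∂γ +
      ∫ p, inner ℝ (p.1 - p.2) (u p) ∂γ := by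
    rw [← integral_const_mul, ← integral_add (hVu.const_mul 2) hxu]
    congr 1
    ext p
    have h1 : inner ℝ (deviation ρ p) (u p) = ‖deviation ρ p‖ := inner_unitVector _
    have h2 : deviation ρ p = (2 : ℝ) • potentialGrad ρ p.1 + (p.1 - p.2) := by
      rw [deviation, transportMap]
      abel
    rw [← h1, h2, inner_add_left, inner_smul_left]
    simp
  have hVM : ∫ p, inner ℝ (potentialGrad ρ p.1) (u p) ∂γ ≤ M := by
    have h1 : ∫ p, inner ℝ (potentialGrad ρ p.1) (u p) ∂γ ≤ ∫ _ : Plane × Plane, M ∂γ := by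
      refine integral_mono hVu (integrable_const M) fun p => ?_
      refine (real_inner_le_norm _ _).trans ?_
      exact (mul_le_of_le_one_right (norm_nonneg _) (hu1 p)).trans (hM _)
    simpa using h1
  obtain ⟨hp1, hp2⟩ := abs_le.1 hpot
  have hlin : 2 * (logPair (smear γ a fun _ => τ) ρ - logPair ρ ρ) +
      ((planCost (smearPlan γ a fun _ => τ)).toReal - (planCost γ).toReal) ≤
      -(τ * ∫ p, ‖deviation ρ p‖ ∂γ) + (4 * τ * η + τ ^ 2) := by
    rw [hdev]
    linarith
  have hquad : logPair ρ ρ - 2 * logPair (smear γ a fun _ => τ) ρ +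
      logPair (smear γ a fun _ => τ) (smear γ a fun _ => τ) ≤
      -logPair ρ ρ + 2 * τ * M + 4 * τ * η - Real.log τ := by
    have := mul_le_mul_of_nonneg_left hVM hτ.le
    linarith
  have h1 := mul_le_mul_of_nonneg_left hlin hs0
  have h2 := mul_le_mul_of_nonneg_left hquad (sq_nonneg s)
  linarith

/-- Almost optimal plans are close to the graph of `transportMap ρ`. -/
theorem IsMinimizer.exists_integral_norm_deviation_le (hρ : IsMinimizer ρ₀ ρ) (hρ₀ : IsP2 ρ₀)
    (hC : 0 ≤ C) (hle : ρ ≤ ENNReal.ofReal C • volume) {δ : ℝ} (hδ : 0 < δ) :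
    ∃ ε > 0, ∀ γ, IsPlan ρ ρ₀ γ → planCost γ ≤ wassersteinSq ρ ρ₀ + ENNReal.ofReal ε →
      ∫ p, ‖deviation ρ p‖ ∂γ ≤ δ := by
  have := hρ.1.1
  -- In units of τδ the errors are 4/10 from 4τη, 1/10 from τ² ≤ τη, and 1/4 each from sQ and ε/s,
  -- adding up to 1. The choices of τ, s, ε precede that of γ.
  obtain ⟨τ, hτ, hτη, happ⟩ := exists_radius_potential_approx hC hle hρ.1 (η := δ / 10)
    (by positivity)
  have hM := norm_potentialGrad_le hC hle
  set M := (4 * Real.pi * C + 1) * logModulus 2 + 1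
  set Q := -logPair ρ ρ + 2 * τ * M + 4 * τ * (δ / 10) - Real.log τ with hQ
  have hQ1 : 0 < |Q| + 1 := by positivity
  obtain ⟨s, hs0, hs1, hs⟩ : ∃ s > 0, s ≤ 1 ∧ s * (|Q| + 1) ≤ τ * δ / 4 := by
    refine ⟨min 1 (τ * δ / 4 / (|Q| + 1)), lt_min one_pos (by positivity), min_le_left _ _, ?_⟩
    calc _ ≤ τ * δ / 4 / (|Q| + 1) * (|Q| + 1) := by gcongr; exact min_le_right _ _
      _ = _ := div_mul_cancel₀ _ hQ1.ne'
  refine ⟨s * (τ * δ / 4), by positivity, fun γ hγ hopt => ?_⟩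
  have h := hρ.integral_norm_deviation_le hρ₀ hC hle hγ (by positivity) hopt hτ (by positivity) hM
    happ hs0.le hs1
  rw [← hQ] at h
  have h1 : s * Q ≤ τ * δ / 4 := by nlinarith [le_abs_self Q]
  have h2 : s * (τ * ∫ p, ‖deviation ρ p‖ ∂γ) ≤ s * (τ * δ) := by
    refine h.trans ?_
    have : s * (s * Q) ≤ s * (τ * δ / 4) := by gcongr
    have : s * (τ * τ) ≤ s * (τ * (δ / 10)) := by gcongr
    nlinarith [mul_pos hs0 (mul_pos hτ hδ)]
  exact le_of_mul_le_mul_left (le_of_mul_le_mul_left h2 hs0) hτ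

/-! ### The optimal map -/

lemma isPlan_map_prodMk {S : Plane → Plane} (hS : AEMeasurable S ρ) (hmap : ρ.map S = ρ₀) :
    IsPlan ρ ρ₀ (ρ.map fun x => (x, S x)) := by
  have hp : AEMeasurable (fun x => (x, S x)) ρ := aemeasurable_id.prodMk hS
  constructor
  · rw [AEMeasurable.map_map_of_aemeasurable measurable_fst.aemeasurable hp]
    exact Measure.map_id
  · rw [AEMeasurable.map_map_of_aemeasurable measurable_snd.aemeasurable hp]
    exact hmap

lemma planCost_map_prodMk {S : Plane → Plane} (hS : AEMeasurable S ρ) :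
    planCost (ρ.map fun x => (x, S x)) = 2⁻¹ * ∫⁻ x, ‖x - S x‖ₑ ^ 2 ∂ρ := by
  rw [planCost, lintegral_map' (by fun_prop) (by fun_prop)]

/-- Characteristic functions at t differ by at most |t|∫|deviation| dγ for every plan γ, and almost
optimal plans make this arbitrarily small. -/
lemma IsMinimizer.map_transportMap (hρ : IsMinimizer ρ₀ ρ) (hρ₀ : IsP2 ρ₀)
    (hC : 0 ≤ C) (hle : ρ ≤ ENNReal.ofReal C • volume) : ρ.map (transportMap ρ) = ρ₀ := by
  have := hρ.1.1
  have := hρ₀.1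
  have hVm := (continuous_potentialGrad hC hle).measurable
  have hTm : Measurable (transportMap ρ) := by
    unfold transportMap
    fun_prop
  have : IsProbabilityMeasure (ρ.map (transportMap ρ)) :=
    Measure.isProbabilityMeasure_map hTm.aemeasurable
  refine Measure.ext_of_charFun (funext fun t => ?_)
  rw [← sub_eq_zero, ← norm_le_zero_iff]
  refine le_of_forall_pos_le_add fun δ hδ => ?_
  obtain ⟨ε, hε, h⟩ := hρ.exists_integral_norm_deviation_le hρ₀ hC hle
    (δ := δ / (‖t‖ + 1)) (by positivity)
  obtain ⟨γ, hγ, hopt⟩ := exists_isPlan_planCost_le hρ.1 hρ₀ hε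
  have := hγ.isProbabilityMeasure
  have h1 := h γ hγ hopt
  have hTexp : Measurable fun x => Complex.exp (inner ℝ (transportMap ρ x) t * Complex.I) := by
    fun_prop
  have e1 : charFun (ρ.map (transportMap ρ)) t =
      ∫ p : Plane × Plane, Complex.exp (inner ℝ (transportMap ρ p.1) t * Complex.I) ∂γ := by
    have h := integral_map (μ := γ) measurable_fst.aemeasurable hTexp.aestronglyMeasurable
    rw [hγ.1] at h
    rw [charFun_apply, integral_map hTm.aemeasurable (by fun_prop), h]
  have e2 : charFun ρ₀ t = ∫ p : Plane × Plane, Complex.exp (inner ℝ p.2 t * Complex.I) ∂γ := by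
    rw [charFun_apply, ← hγ.2, integral_map measurable_snd.aemeasurable (by fun_prop)]
  have hexp : ∀ r : ℝ, ‖Complex.exp (r * Complex.I)‖ ≤ 1 := fun r =>
    (Complex.norm_exp_ofReal_mul_I r).le
  have i1 : Integrable (fun p : Plane × Plane =>
      Complex.exp (inner ℝ (transportMap ρ p.1) t * Complex.I)) γ :=
    Integrable.of_bound (C := 1) (hTexp.comp measurable_fst).aestronglyMeasurable
      (.of_forall fun p => hexp _)
  have i2 : Integrable (fun p : Plane × Plane => Complex.exp (inner ℝ p.2 t * Complex.I)) γ :=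
    Integrable.of_bound (C := 1) (by fun_prop) (.of_forall fun p => hexp _)
  rw [e1, e2, ← integral_sub i1 i2, zero_add]
  calc _ ≤ ∫ p, ‖deviation ρ p‖ * ‖t‖ ∂γ := by
        refine norm_integral_le_of_norm_le
          ((hγ.integrable_deviation hρ.1 hρ₀ hC hle).mul_const _) (.of_forall fun p => ?_)
        have h3 : Complex.exp (inner ℝ (transportMap ρ p.1) t * Complex.I) -
            Complex.exp (inner ℝ p.2 t * Complex.I) = Complex.exp (inner ℝ p.2 t * Complex.I) *
            (Complex.exp (Complex.I * (inner ℝ (deviation ρ p) t : ℝ)) - 1) := by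
          rw [mul_sub, ← Complex.exp_add, deviation, inner_sub_left]
          push_cast
          ring_nf
        rw [h3, norm_mul, Complex.norm_exp_ofReal_mul_I, one_mul]
        refine (Real.norm_exp_I_mul_ofReal_sub_one_le).trans ?_
        exact norm_inner_le_norm _ _
    _ ≤ δ / (‖t‖ + 1) * ‖t‖ := by
        rw [integral_mul_const]
        gcongr
    _ ≤ δ := by
        rw [div_mul_eq_mul_div, div_le_iff₀ (by positivity)]
        nlinarith

theorem IsMinimizer.isOptimalMap_transportMap (hρ : IsMinimizer ρ₀ ρ) (hρ₀ : IsP2 ρ₀)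
    (hC : 0 ≤ C) (hle : ρ ≤ ENNReal.ofReal C • volume) :
    IsOptimalMap ρ ρ₀ (transportMap ρ) := by
  have := hρ.1.1
  have hVm := (continuous_potentialGrad hC hle).measurable
  have hTm : Measurable (transportMap ρ) := by
    unfold transportMap
    fun_prop
  have hmap := hρ.map_transportMap hρ₀ hC hle
  have hW := wassersteinSq_ne_top hρ.1 hρ₀
  have hplan := isPlan_map_prodMk hTm.aemeasurable hmap
  have hcost := planCost_map_prodMk (ρ := ρ) hTm.aemeasurable
  refine ⟨hTm.aemeasurable, hmap, le_antisymm ?_ ?_⟩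
  swap
  · rw [← hcost]
    exact wassersteinSq_le hplan
  rw [← hcost, ← ENNReal.toReal_le_toReal (hplan.planCost_ne_top hρ.1 hρ₀) hW]
  have hTi := hplan.integrable_sq hρ.1 hρ₀
  have hpm : AEMeasurable (fun x => (x, transportMap ρ x)) ρ := by fun_prop
  rw [toReal_planCost, integral_map hpm hTi.1]
  replace hTi := (integrable_map_measure hTi.1 hpm).1 hTi
  have hM := norm_potentialGrad_le hC hle
  set M := (4 * Real.pi * C + 1) * logModulus 2 + 1 with hMdef
  have hM0 : 0 ≤ M := (norm_nonneg _).trans (hM 0)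
  refine le_of_forall_pos_le_add fun δ hδ => ?_
  obtain ⟨ε, hε, h⟩ := hρ.exists_integral_norm_deviation_le hρ₀ hC hle
    (δ := δ / (4 * (M + 1))) (by positivity)
  obtain ⟨γ, hγ, hopt⟩ := exists_isPlan_planCost_le hρ.1 hρ₀ (lt_min hε (half_pos hδ))
  have h1 := h γ hγ (hopt.trans (by gcongr; exact min_le_left _ _))
  have hc := toReal_planCost_le_add (by positivity) hW hopt
  rw [toReal_planCost] at hc
  have hdi := hγ.integrable_deviation hρ.1 hρ₀ hC hle
  have hsq := hγ.integrable_sq hρ.1 hρ₀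
  -- Expanding |x-y|² about x - T(x) = -2∇U(x), the cross term is linear in the deviation because ∇U
  -- is bounded, and the squared deviation has the favourable sign.
  have h2 : ∫ x, ‖x - transportMap ρ x‖ ^ 2 ∂ρ ≤
      ∫ p, ‖p.1 - p.2‖ ^ 2 ∂γ + 4 * M * ∫ p, ‖deviation ρ p‖ ∂γ := by
    rw [← hγ.integral_comp_fst (f := fun x => ‖x - transportMap ρ x‖ ^ 2) hTi.1,
      ← integral_const_mul, ← integral_add hsq (hdi.const_mul _)]
    refine integral_mono (hγ.integrable_comp_fst hTi) (hsq.add (hdi.const_mul _)) fun p => ?_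
    have e : p.1 - p.2 = (p.1 - transportMap ρ p.1) + deviation ρ p := by
      rw [deviation]
      abel
    have h3 : inner ℝ (p.1 - transportMap ρ p.1) (deviation ρ p) =
        -(2 * inner ℝ (potentialGrad ρ p.1) (deviation ρ p)) := by
      rw [show p.1 - transportMap ρ p.1 = -((2 : ℝ) • potentialGrad ρ p.1) by
        rw [transportMap]; abel, inner_neg_left, inner_smul_left]
      simp
    have h4 := (real_inner_le_norm (potentialGrad ρ p.1) (deviation ρ p)).trans
      (mul_le_mul_of_nonneg_right (hM p.1) (norm_nonneg _))
    simp only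
    rw [e, norm_add_sq_real, h3]
    nlinarith [sq_nonneg ‖deviation ρ p‖]
  have h5 : M * ∫ p, ‖deviation ρ p‖ ∂γ ≤ δ / 4 := by
    calc _ ≤ M * (δ / (4 * (M + 1))) := by gcongr
      _ ≤ δ / 4 := by
        rw [mul_div_assoc', div_le_div_iff₀ (by positivity) (by positivity)]
        nlinarith
  have h6 := min_le_right ε (δ / 2)
  simp only
  linarith

/-- The plan of an optimal map is ε-optimal for every ε > 0, so its deviation integrates to zero. -/
theorem IsMinimizer.ae_eq_transportMap (hρ : IsMinimizer ρ₀ ρ) (hρ₀ : IsP2 ρ₀)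
    (hC : 0 ≤ C) (hle : ρ ≤ ENNReal.ofReal C • volume) {S : Plane → Plane}
    (hS : IsOptimalMap ρ ρ₀ S) : ∀ᵐ x ∂ρ, S x = transportMap ρ x := by
  have := hρ.1.1
  obtain ⟨hSm, hmap, hcost⟩ := hS
  have hplan := isPlan_map_prodMk hSm hmap
  rw [← planCost_map_prodMk hSm] at hcost
  have hdi := hplan.integrable_deviation hρ.1 hρ₀ hC hle
  have h0 : ∫ p, ‖deviation ρ p‖ ∂(ρ.map fun x => (x, S x)) ≤ 0 := by
    refine le_of_forall_pos_le_add fun δ hδ => ?_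
    obtain ⟨ε, -, h⟩ := hρ.exists_integral_norm_deviation_le hρ₀ hC hle hδ
    rw [zero_add]
    exact h _ hplan (hcost.le.trans le_self_add)
  have h1 := (integral_eq_zero_iff_of_nonneg (fun p => norm_nonneg _) hdi).1
    (le_antisymm h0 (integral_nonneg fun p => norm_nonneg _))
  filter_upwards [ae_of_ae_map (aemeasurable_id.prodMk hSm) h1] with x hx
  simp only [Pi.zero_apply, norm_eq_zero, deviation, id_eq, sub_eq_zero] at hx
  exact hx.symm

end Minimizer

/-! ### Square integrability of the Fourier transform -/

section Fourier

open FourierTransform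

variable {V : Type*} [NormedAddCommGroup V] [InnerProductSpace ℝ V] [FiniteDimensional ℝ V]
  [MeasurableSpace V] [BorelSpace V]

/-- The multiplication formula, used to identify the integral and the L² Fourier transforms as
distributions. -/
lemma integral_fourier_schwartz_smul (φ : SchwartzMap V ℂ) {F : V → ℂ} (hF : Integrable F) :
    ∫ x, (𝓕 φ : SchwartzMap V ℂ) x • F x = ∫ ξ, φ ξ • 𝓕 F ξ := by
  have := VectorFourier.integral_fourierIntegral_smul_eq_flip (μ := volume) (ν := volume)
    (L := innerₗ V) (f := φ) (g := F) Real.continuous_fourierChar continuous_inner φ.integrable hF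
  simp only [flip_innerₗ] at this
  rw [SchwartzMap.fourier_coe]
  exact this

/-- The Fourier integral of an integrable and square integrable function is square integrable. -/
theorem memLp_two_fourier {F : V → ℂ} (h1 : Integrable F) (h2 : MemLp F 2) :
    MemLp (𝓕 F) 2 := by
  set G : Lp ℂ 2 (volume : Measure V) := h2.toLp F
  have hcont : Continuous (𝓕 F) := VectorFourier.fourierIntegral_continuous
    Real.continuous_fourierChar (L := innerₗ V) continuous_inner h1
  refine (Lp.memLp (𝓕 G)).ae_eq ?_
  -- Both transforms are locally integrable, so agreement against smooth compactly supported
  -- functions is enough.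
  refine ae_eq_of_integral_contDiff_smul_eq ((Lp.memLp (𝓕 G)).locallyIntegrable (by norm_num))
    hcont.locallyIntegrable fun g hg hgc => ?_
  have hc : HasCompactSupport fun x => (g x : ℂ) := hgc.comp_left (g := Complex.ofReal) rfl
  set φ : SchwartzMap V ℂ := hc.toSchwartzMap (Complex.ofRealCLM.contDiff.comp hg)
  have hφ : ∀ x, φ x = g x := fun x => rfl
  have e := congrArg (fun T => T φ) (Lp.fourier_toTemperedDistribution_eq G)
  simp only [TemperedDistribution.fourier_apply, Lp.toTemperedDistribution_apply, hφ] at e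
  simp only [Complex.coe_smul] at e
  rw [← e]
  have e2 : ∫ x, (𝓕 φ : SchwartzMap V ℂ) x • G x = ∫ x, (𝓕 φ : SchwartzMap V ℂ) x • F x := by
    refine integral_congr_ae ?_
    filter_upwards [h2.coeFn_toLp] with x hx
    rw [hx]
  rw [e2, integral_fourier_schwartz_smul φ h1]
  simp only [hφ, Complex.coe_smul]

end Fourier

theorem memLp_fourierMeasure {f : Plane → ℝ} (hfm : Measurable f) (hf0 : ∀ x, 0 ≤ f x)
    (hf : MemLp f ∞ volume) {ρ : Measure Plane} [IsFiniteMeasure ρ]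
    (hρ : ρ = volume.withDensity fun x => ENNReal.ofReal (f x)) :
    MemLp (fourierMeasure ρ) 2 volume := by
  have hfin : ∫⁻ x, ENNReal.ofReal (f x) < ∞ := by
    have := measure_lt_top ρ Set.univ
    rwa [hρ, withDensity_apply _ MeasurableSet.univ, setLIntegral_univ] at this
  have hi : Integrable f :=
    ⟨hfm.aestronglyMeasurable, (hasFiniteIntegral_iff_ofReal (.of_forall hf0)).2 hfin⟩
  -- f² is the product of an integrable and an essentially bounded function.
  have hsq : MemLp f 2 := by
    rw [memLp_two_iff_integrable_sq hfm.aestronglyMeasurable]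
    simp_rw [sq]
    exact hi.mul_of_top_right hf
  have e : fourierMeasure ρ = FourierTransform.fourier fun x => (f x : ℂ) := by
    ext ξ
    rw [fourierMeasure, hρ, integral_withDensity_eq_integral_toReal_smul (by fun_prop) (by simp),
      Real.fourier_eq']
    refine integral_congr_ae (.of_forall fun x => ?_)
    simp only [ENNReal.toReal_ofReal (hf0 x), Complex.real_smul, smul_eq_mul]
    rw [mul_comm]
    congr 2
    push_cast
    ring
  rw [e]
  exact memLp_two_fourier hi.ofReal hsq.ofReal

end LogTransport

end

theorem theoremB (ρ₀ ρ : Measure LogTransport.Plane) (hρ₀ : LogTransport.IsP2 ρ₀)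
    (hρ : LogTransport.IsMinimizer ρ₀ ρ) :
    MemLp (LogTransport.fourierMeasure ρ) 2 volume ∧
    (∃ f : LogTransport.Plane → ℝ, (∀ x, 0 ≤ f x) ∧ MemLp f ∞ volume ∧
      ρ = volume.withDensity fun x => ENNReal.ofReal (f x)) ∧
    ∃ U : LogTransport.Plane → ℝ,
      (∀ x, LogTransport.logPotential ρ x = (U x : EReal)) ∧
      Differentiable ℝ U ∧
      LogTransport.IsOptimalMap ρ ρ₀ (fun x => x + (2 : ℝ) • gradient U x) ∧
      (∀ S : LogTransport.Plane → LogTransport.Plane, LogTransport.IsOptimalMap ρ ρ₀ S →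
        ∀ᵐ x ∂ρ, S x = x + (2 : ℝ) • gradient U x) ∧
      LogTransport.IsLogLipschitz (gradient U) := by
  have := hρ.1.1
  have hle := hρ.le_smul_volume hρ₀
  have hC : 0 ≤ (Real.pi * Real.log 2)⁻¹ := by
    have := Real.log_pos one_lt_two
    positivity
  obtain ⟨f, hfm, hf0, hf, hρf⟩ := LogTransport.exists_bounded_density hle
  have hgrad := LogTransport.hasGradientAt_potential hC hle hρ.1
  have hgrad' : gradient (LogTransport.potential ρ) = LogTransport.potentialGrad ρ :=
    funext fun x => (hgrad x).gradient
  refine ⟨LogTransport.memLp_fourierMeasure hfm hf0 hf hρf, ⟨f, hf0, hf, hρf⟩,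
    LogTransport.potential ρ, LogTransport.logPotential_eq_potential hC hle hρ.1,
    fun x => (hgrad x).differentiableAt, ?_⟩
  rw [hgrad']
  exact ⟨hρ.isOptimalMap_transportMap hρ₀ hC hle,
    fun S hS => hρ.ae_eq_transportMap hρ₀ hC hle hS,
    LogTransport.isLogLipschitz_potentialGrad hC hle⟩
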